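/- Let $\sigma>0$, $T>0$, $m\ge 1$, $\delta=T/(m+1)$, and let $X_t=x_0+\sigma W_t$ be a scaled Brownian motion on $\mathbb{R}$. Let $\mathbb{G}$ be the conditional law of the knots $\mathcal{G}=(X_{\delta},X_{2\delta},\dots,X_{m\delta})$ given $X_0=x_0$ and $X_T=x_T$ (the bridge law at equidistant anchors). Consider Gibbs samplers for $\mathbb{G}$, in which updating a set of knots means redrawing them from their conditional law under $\mathbb{G}$ given all other knots. A sweep of the checkerboard scheme updates in turn two sets that partition the anchors into nonempty, interlaced sets (between any two anchors of one set there is an anchor of the other); a sweep of the lexicographic scheme updates the knots $1,\dots,m$ singly, in this order; a sweep of the random scheme consists of $m$ steps, in each of which one uniformly chosen knot is updated. The $L^2$-convergence rate of such a sampler, with sweep kernel $P$, is the smallest $\rho\ge 0$ such that for all $f\in L^2(\mathbb{G})$ and all $r>\rho$ there is $V_f>0$ with $\|P^nf-\mathbb{G}(f)\|_{L^2(\mathbb{G})}\le V_f r^n$ for all $n$. Then the partial correlation is $c(\delta)=\mathrm{Corr}(X_\delta,X_{2\delta}\mid X_0,X_{3\delta})=\tfrac12$. The checkerboard scheme (when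 $m\ge2$) and the lexicographic scheme have the same $L^2$-convergence rate $\rho_{m,T}$, which is also the spectral radius of the matrix $B$ of each of these two schemes, defined by $\mathbb{E}[\mathcal{G}^{(l+1)}\mid\mathcal{G}^{(l)}]=B\,\mathcal{G}^{(l)}+b$, and equals $\lambda_{\max}(A)^2$, where $A=I-\mathrm{diag}(\Lambda_{11}^{-1},\dots,\Lambda_{mm}^{-1})\Lambda$ and $\Lambda$ is the inverse of the covariance matrix of $\mathbb{G}$. This rate and the rate $\rho_{\mathrm{rand}}$ of the random scheme are $$\rho_{m,T}=\cos^2\!\Big(\frac{\pi}{m+1}\Big),\qquad \rho_{\mathrm{rand}}=\left[\frac{m-1+\cos\big(\frac{\pi}{m+1}\big)}{m}\right]^m .$$ In particular, as $m\to\infty$, $$\rho_{m,T}=1-\Big(\frac{\pi}{m+1}\Big)^2+O(m^{-4}),\qquad \rho_{\mathrm{rand}}=1-\frac12\Big(\frac{\pi}{m+1}\Big)^2+O(m^{-4}),$$ with implied constants independent of $T$, $\sigma$, $x_0$ and $x_T$. -/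

import Mathlib

open MeasureTheory ProbabilityTheory
open scoped NNReal ENNReal

namespace BridgeBlocking

/-! ### Diffusion bridges observed at anchors -/

/-- The equidistant anchors `k_i = i T / (m + 1)`, `i = 1, …, m`, in `(0, T)`
(here indexed by `0, …, m - 1`). -/
noncomputable def anchor (m : ℕ) (T : ℝ≥0) (i : Fin m) : ℝ≥0 :=
  ((i : ℕ) + 1) * (T / (m + 1))

/-- `G` is the conditional law of the knots `(X_{k_1}, …, X_{k_m})` given `X_T = x`: the value at
`x` of the weakly continuous version of the regular conditional distribution of the knots given
`X_T`. (The processes considered start at a fixed point, so that conditioning on `X_0` as well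
changes nothing.) -/
def IsBridgeLaw {Ω : Type*} [MeasurableSpace Ω] (P : Measure Ω) (X : ℝ≥0 → Ω → ℝ) {m : ℕ}
    (k : Fin m → ℝ≥0) (T : ℝ≥0) (x : ℝ) (G : ProbabilityMeasure (Fin m → ℝ)) : Prop :=
  ∃ (κ : Kernel ℝ (Fin m → ℝ)) (g : ℝ → ProbabilityMeasure (Fin m → ℝ)),
    HasCondDistrib (fun ω i ↦ X (k i) ω) (X T) κ P ∧ Continuous g ∧
      (∀ z, κ z = (g z : Measure (Fin m → ℝ))) ∧ g x = G

/-- The correlation of the coordinates `i` and `j` under the law `G`. -/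
noncomputable def corr {m : ℕ} (G : ProbabilityMeasure (Fin m → ℝ)) (i j : Fin m) : ℝ :=
  cov[fun x ↦ x i, fun x ↦ x j; (G : Measure (Fin m → ℝ))] /
    √(Var[fun x ↦ x i; (G : Measure (Fin m → ℝ))] * Var[fun x ↦ x j; (G : Measure (Fin m → ℝ))])

/-- The covariance matrix `Σ` of the law `G`. -/
noncomputable def covMatrix {m : ℕ} (G : ProbabilityMeasure (Fin m → ℝ)) :
    Matrix (Fin m) (Fin m) ℝ :=
  Matrix.of fun i j ↦ cov[fun x ↦ x i, fun x ↦ x j; (G : Measure (Fin m → ℝ))]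

/-- `A = I - diag(Λ₁₁⁻¹, …, Λₘₘ⁻¹) Λ`, with `Λ = Σ⁻¹` the precision matrix. -/
noncomputable def matrixA {m : ℕ} (G : ProbabilityMeasure (Fin m → ℝ)) :
    Matrix (Fin m) (Fin m) ℝ :=
  1 - Matrix.diagonal (fun i ↦ ((covMatrix G)⁻¹ i i)⁻¹) * (covMatrix G)⁻¹

/-! ### Blocked Gibbs samplers -/

/-- The update of the knots with index in `S`: the transition kernel that redraws these knots from
their conditional law under `G` given all the other knots, which are kept. -/
noncomputable def gibbsUpdate {m : ℕ} (G : ProbabilityMeasure (Fin m → ℝ)) (S : Finset (Fin m)) :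
    Kernel (Fin m → ℝ) (Fin m → ℝ) :=
  (condDistrib id (fun (x : Fin m → ℝ) (j : {j // j ∉ S}) ↦ x j)
    (G : Measure (Fin m → ℝ))).comap (fun x j ↦ x j) (by fun_prop)

/-- One step of the sampler: draw the index `I` of a block from `q`, then update block `I`. -/
noncomputable def gibbsStep {m k : ℕ} (G : ProbabilityMeasure (Fin m → ℝ))
    (𝒜 : Fin k → Finset (Fin m)) (q : PMF (Fin k)) : Kernel (Fin m → ℝ) (Fin m → ℝ) where
  toFun x := ∑ j, q j • gibbsUpdate G (𝒜 j) x
  measurable' := by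
    refine Measure.measurable_of_measurable_coe _ fun s hs ↦ ?_
    simp only [Measure.coe_finsetSum, Finset.sum_apply, Measure.smul_apply, smul_eq_mul]
    exact Finset.measurable_sum _ fun j _ ↦
      ((gibbsUpdate G (𝒜 j)).measurable_coe hs).const_mul _

/-- A full sweep: the steps `i = 1, …, k` one after the other, the block updated in step `i` being
drawn from `q i`. -/
noncomputable def sweep {m k : ℕ} (G : ProbabilityMeasure (Fin m → ℝ))
    (𝒜 : Fin k → Finset (Fin m)) (q : Fin k → PMF (Fin k)) : Kernel (Fin m → ℝ) (Fin m → ℝ) :=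
  (List.finRange k).foldl (fun K i ↦ gibbsStep G 𝒜 (q i) ∘ₖ K) Kernel.id

/-- The sets `𝒜 i` are nonempty and form a partition of the (indices of the) anchors. -/
def IsBlocking {m k : ℕ} (𝒜 : Fin k → Finset (Fin m)) : Prop :=
  (∀ i, (𝒜 i).Nonempty) ∧ (∀ i j, i ≠ j → Disjoint (𝒜 i) (𝒜 j)) ∧ ∀ a, ∃ i, a ∈ 𝒜 i

/-- Between any two anchors of one set there is an anchor of the other set. -/
def Interlaced {m : ℕ} (𝒜 : Fin 2 → Finset (Fin m)) : Prop :=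
  ∀ i j, i ≠ j → ∀ a ∈ 𝒜 i, ∀ c ∈ 𝒜 i, a < c → ∃ b ∈ 𝒜 j, a < b ∧ b < c

/-- The sweep of the checkerboard scheme: two (interlaced) blocks, updated in turn. -/
noncomputable def checkerboardSweep {m : ℕ} (G : ProbabilityMeasure (Fin m → ℝ))
    (𝒜 : Fin 2 → Finset (Fin m)) : Kernel (Fin m → ℝ) (Fin m → ℝ) :=
  sweep G 𝒜 PMF.pure

/-- The sweep of the lexicographic scheme: the knots are updated singly, in temporal order. -/
noncomputable def lexSweep {m : ℕ} (G : ProbabilityMeasure (Fin m → ℝ)) :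
    Kernel (Fin m → ℝ) (Fin m → ℝ) :=
  sweep G (fun i : Fin m ↦ {i}) PMF.pure

/-- The sweep of the random scheme: `m` steps, in each of which a uniformly random knot is
updated. -/
noncomputable def randomSweep {m : ℕ} [NeZero m] (G : ProbabilityMeasure (Fin m → ℝ)) :
    Kernel (Fin m → ℝ) (Fin m → ℝ) :=
  sweep G (fun i : Fin m ↦ {i}) fun _ ↦ PMF.uniformOfFintype (Fin m)

/-! ### Convergence rates -/

/-- `ρ` is the `L²`-convergence rate of the Markov chain with transition kernel `K` and invariant
law `G`: the minimal `ρ ≥ 0` such that for all square integrable `f` and all `r > ρ` there is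
`V > 0` with `‖Kⁿ f - G(f)‖_{L²(G)} ≤ V rⁿ` for all `n`. -/
def IsL2Rate {m : ℕ} (K : Kernel (Fin m → ℝ) (Fin m → ℝ))
    (G : ProbabilityMeasure (Fin m → ℝ)) (ρ : ℝ) : Prop :=
  IsLeast {ρ : ℝ | 0 ≤ ρ ∧ ∀ f : (Fin m → ℝ) → ℝ, MemLp f 2 (G : Measure (Fin m → ℝ)) →
    ∀ r > ρ, ∃ V > 0, ∀ n : ℕ,
      eLpNorm (fun x ↦ ∫ y, f y ∂((K ^ n) x) - ∫ y, f y ∂(G : Measure (Fin m → ℝ))) 2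
        (G : Measure (Fin m → ℝ)) ≤ ENNReal.ofReal (V * r ^ n)} ρ

/-- `B` is the autoregression matrix of the chain with transition kernel `K` and invariant law `G`:
for some vector `b` and almost every state `x`, the mean of the next state is `B x + b`. -/
def IsSweepMatrix {m : ℕ} (K : Kernel (Fin m → ℝ) (Fin m → ℝ))
    (G : ProbabilityMeasure (Fin m → ℝ)) (B : Matrix (Fin m) (Fin m) ℝ) : Prop :=
  ∃ b : Fin m → ℝ, ∀ᵐ x ∂(G : Measure (Fin m → ℝ)), ∀ i,
    Integrable (fun y : Fin m → ℝ ↦ y i) (K x) ∧ ∫ y, y i ∂(K x) = (B.mulVec x + b) i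

/-- `ρ` is the spectral radius (the largest modulus of a complex eigenvalue) of the real
matrix `B`. -/
def HasSpectralRadius {m : ℕ} (B : Matrix (Fin m) (Fin m) ℝ) (ρ : ℝ) : Prop :=
  0 ≤ ρ ∧ spectralRadius ℂ (B.map ((↑) : ℝ → ℂ)) = ENNReal.ofReal ρ

end BridgeBlocking

/-! Each row of the bridge covariance is a discrete Green's function on the path of anchors. Hence
the residual of a knot, after subtracting its prediction from the two neighbours, is uncorrelated
with every other knot (`isAutoregressive_bridgeLaw`). So `A` is half the adjacency matrix of the
path, with positive eigenvector `s i = sin (i π / (m + 1))` (anchors numbered from 1) and eigenvalue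
`γ = cos (π / (m + 1))`.

Updating a set of pairwise non-adjacent knots replaces `x` by `B x` plus independent noise, with `B`
entrywise nonnegative. On `L²` this is a conditional expectation, thus a self-adjoint projection; it
acts on centred coordinates through `B` and on coordinatewise Lipschitz constants through `Bᵀ`
(`isAffine_updateOp`). Both properties survive products and convex combinations, so they hold for
whole sweeps, and the adjoint of a sweep is the sweep in reverse order.

If adjacent knots lie in consecutive blocks, `γ ^ l i * s i`, with `l i` the block of `i`, is an
eigenvector of the sweep matrix with eigenvalue `γ²` (`sweep_mulVec`). This treats the checkerboard
and lexicographic schemes at once; for the random scheme `s` itself is an eigenvector. Positivity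
makes these eigenvalues spectral radii by a Perron argument.

A sweep `T` need not be self-adjoint, so the `L²` bound is drawn from `S = (T*)ⁿ Tⁿ`. Lipschitz
constants show that `‖Sᵏ F‖` is at most a constant times `qᵏ`, where `q` is a constant times `ρ²ⁿ`;
self-adjointness upgrades this to `‖S F‖ ≤ q ‖F‖`, and density covers all of `L²`
(`IsAffine.norm_pow_sub_le`). A left eigenvector of `B` yields a linear eigenfunction, which shows
that the rate cannot be smaller (`Represents.isL2Rate`). -/

namespace BridgeBlocking

/-! ### Operators that contract coordinatewise Lipschitz constants -/

/-- `f` is Lipschitz with constant `a i` in the coordinate `i`. -/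
def CoordLipschitz {m : ℕ} (f : (Fin m → ℝ) → ℝ) (a : Fin m → ℝ) : Prop :=
  (∀ i, 0 ≤ a i) ∧ ∀ x y, |f x - f y| ≤ ∑ i, a i * |x i - y i|

/-- The Hilbert space `L²(μ)`. -/
abbrev L2 {m : ℕ} (μ : Measure (Fin m → ℝ)) := Lp ℝ 2 μ

/-- The operator `T` acts on affine functions through `B`, with `ξ` the centred coordinates, and
transforms coordinatewise Lipschitz constants by `Bᵀ`. -/
structure IsAffine {m : ℕ} {μ : Measure (Fin m → ℝ)} [IsProbabilityMeasure μ]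
    (ξ : Fin m → L2 μ) (T : L2 μ →L[ℝ] L2 μ) (B : Matrix (Fin m) (Fin m) ℝ) : Prop where
  nonneg : ∀ i j, 0 ≤ B i j
  map_one : T (Lp.const 2 μ 1) = Lp.const 2 μ 1
  map_coord : ∀ i, T (ξ i) = ∑ j, B i j • ξ j
  lipschitz : ∀ (F : L2 μ) (f : (Fin m → ℝ) → ℝ) (a : Fin m → ℝ), F =ᵐ[μ] f →
    CoordLipschitz f a → ∃ g, T F =ᵐ[μ] g ∧ CoordLipschitz g (B.transpose.mulVec a)

section
variable {m : ℕ} {μ : Measure (Fin m → ℝ)} [IsProbabilityMeasure μ] {ξ : Fin m → L2 μ}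
  {T T₁ T₂ : L2 μ →L[ℝ] L2 μ} {B B₁ B₂ : Matrix (Fin m) (Fin m) ℝ}

lemma IsAffine.one : IsAffine ξ 1 1 where
  nonneg i j := by
    rw [Matrix.one_apply]; split_ifs <;> norm_num
  map_one := rfl
  map_coord i := by simp [Matrix.one_apply]
  lipschitz F f a hF hf := ⟨f, hF, by simpa using hf⟩

/-- The matrix order reverses, because an operator turns `ξ i` into a combination given by the
`i`-th row: `T₁` then acts on the coordinates produced by `B₂`. -/
lemma IsAffine.mul (h₁ : IsAffine ξ T₁ B₁) (h₂ : IsAffine ξ T₂ B₂) :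
    IsAffine ξ (T₁ * T₂) (B₂ * B₁) where
  nonneg i j := by
    rw [Matrix.mul_apply]
    exact Finset.sum_nonneg fun l _ ↦ mul_nonneg (h₂.nonneg _ _) (h₁.nonneg _ _)
  map_one := by rw [mul_apply_eq_comp, h₂.map_one, h₁.map_one]
  map_coord i := by
    rw [mul_apply_eq_comp, h₂.map_coord, map_sum]
    simp_rw [map_smul, h₁.map_coord, Finset.smul_sum, smul_smul, Matrix.mul_apply, Finset.sum_smul]
    rw [Finset.sum_comm]
  lipschitz F f a hF hf := by
    obtain ⟨g, hg, hga⟩ := h₂.lipschitz F f a hF hf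
    obtain ⟨k, hk, hka⟩ := h₁.lipschitz _ g _ hg hga
    refine ⟨k, hk, ?_⟩
    rwa [Matrix.transpose_mul, ← Matrix.mulVec_mulVec]

lemma IsAffine.pow (h : IsAffine ξ T B) (n : ℕ) : IsAffine ξ (T ^ n) (B ^ n) := by
  induction n with
  | zero => exact IsAffine.one
  | succ n ih => rw [pow_succ, pow_succ']; exact ih.mul h

lemma CoordLipschitz.sum {ι : Type*} (s : Finset ι) {g : ι → (Fin m → ℝ) → ℝ}
    {a : ι → Fin m → ℝ} {p : ι → ℝ} (hp : ∀ j ∈ s, 0 ≤ p j)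
    (h : ∀ j ∈ s, CoordLipschitz (g j) (a j)) :
    CoordLipschitz (fun x ↦ ∑ j ∈ s, p j * g j x) (fun i ↦ ∑ j ∈ s, p j * a j i) := by
  refine ⟨fun i ↦ Finset.sum_nonneg fun j hj ↦ mul_nonneg (hp j hj) ((h j hj).1 i),
    fun x y ↦ ?_⟩
  simp_rw [Finset.sum_mul]
  rw [Finset.sum_comm, ← Finset.sum_sub_distrib]
  refine (Finset.abs_sum_le_sum_abs _ _).trans (Finset.sum_le_sum fun j hj ↦ ?_)
  rw [← mul_sub, abs_mul, abs_of_nonneg (hp j hj)]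
  simp_rw [mul_assoc]
  rw [← Finset.mul_sum]
  exact mul_le_mul_of_nonneg_left ((h j hj).2 x y) (hp j hj)

lemma IsAffine.sum {ι : Type*} [Fintype ι] {T : ι → L2 μ →L[ℝ] L2 μ}
    {B : ι → Matrix (Fin m) (Fin m) ℝ} {p : ι → ℝ} (hp : ∀ j, 0 ≤ p j) (hp1 : ∑ j, p j = 1)
    (h : ∀ j, IsAffine ξ (T j) (B j)) : IsAffine ξ (∑ j, p j • T j) (∑ j, p j • B j) where
  nonneg i j := by
    simp only [Matrix.sum_apply, Matrix.smul_apply, smul_eq_mul]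
    exact Finset.sum_nonneg fun l _ ↦ mul_nonneg (hp l) ((h l).nonneg _ _)
  map_one := by
    simp [(h _).map_one, ← Finset.sum_smul, hp1]
  map_coord i := by
    simp only [sum_apply, smul_apply, (h _).map_coord,
      Matrix.sum_apply, Matrix.smul_apply, Finset.smul_sum, Finset.sum_smul, smul_smul, smul_eq_mul]
    rw [Finset.sum_comm]
  lipschitz F f a hF hf := by
    choose g hg hga using fun j ↦ (h j).lipschitz F f a hF hf
    refine ⟨fun x ↦ ∑ j, p j * g j x, ?_, ?_⟩
    · rw [sum_apply]
      have h1 : ∀ᵐ x ∂μ, ∀ j, T j F x = g j x := ae_all_iff.2 hg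
      have h2 : ∀ᵐ x ∂μ, ∀ j, (p j • T j F : L2 μ) x = p j * T j F x :=
        ae_all_iff.2 fun j ↦ Lp.coeFn_smul _ _
      filter_upwards [h1, h2, Lp.coeFn_fun_finsetSum Finset.univ fun j ↦ (p j • T j) F]
        with x hx1 hx2 hx3
      rw [hx3]
      exact Finset.sum_congr rfl fun j _ ↦ by
        rw [smul_apply, hx2, hx1]
    · convert CoordLipschitz.sum Finset.univ (fun j _ ↦ hp j) (fun j _ ↦ hga j) using 1
      ext i
      simp only [Matrix.mulVec, dotProduct, Matrix.transpose_apply, Matrix.sum_apply,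
        Matrix.smul_apply, smul_eq_mul, Finset.sum_mul, Finset.mul_sum]
      rw [Finset.sum_comm]
      simp_rw [mul_assoc]

/-! ### Nonnegative matrices with a positive supersolution -/

lemma mulVec_mono {B : Matrix (Fin m) (Fin m) ℝ} (hB : ∀ i j, 0 ≤ B i j) {u v : Fin m → ℝ}
    (h : ∀ i, u i ≤ v i) (i : Fin m) : B.mulVec u i ≤ B.mulVec v i := by
  simp only [Matrix.mulVec, dotProduct]
  exact Finset.sum_le_sum fun j _ ↦ mul_le_mul_of_nonneg_left (h j) (hB i j)

lemma pow_nonneg_apply {B : Matrix (Fin m) (Fin m) ℝ} (hB : ∀ i j, 0 ≤ B i j) (n : ℕ) :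
    ∀ i j, 0 ≤ (B ^ n) i j := by
  induction n with
  | zero => intro i j; rw [pow_zero, Matrix.one_apply]; split_ifs <;> norm_num
  | succ n ih =>
    intro i j
    rw [pow_succ, Matrix.mul_apply]
    exact Finset.sum_nonneg fun l _ ↦ mul_nonneg (ih _ _) (hB _ _)

lemma pow_mulVec_le {B : Matrix (Fin m) (Fin m) ℝ} (hB : ∀ i j, 0 ≤ B i j) {u : Fin m → ℝ}
    {ρ : ℝ} (hρ : 0 ≤ ρ) (h : ∀ i, B.mulVec u i ≤ ρ * u i) (n : ℕ) (i : Fin m) :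
    (B ^ n).mulVec u i ≤ ρ ^ n * u i := by
  induction n generalizing i with
  | zero => simp
  | succ n ih =>
    rw [pow_succ', ← Matrix.mulVec_mulVec]
    calc _ ≤ B.mulVec (ρ ^ n • u) i := mulVec_mono hB ih i
      _ = ρ ^ n * B.mulVec u i := by rw [Matrix.mulVec_smul]; rfl
      _ ≤ ρ ^ n * (ρ * u i) := by gcongr; exact h i
      _ = _ := by ring

/-- The sum of the ratios serves as constant instead of their maximum, so that `m = 0` needs no
separate treatment. -/
lemma exists_le_mul_of_pos (u : Fin m → ℝ) {v : Fin m → ℝ} (hv : ∀ i, 0 < v i) :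
    ∃ D, 0 ≤ D ∧ ∀ i, u i ≤ D * v i := by
  refine ⟨∑ i, |u i| / v i, Finset.sum_nonneg fun i _ ↦ div_nonneg (abs_nonneg _) (hv i).le,
    fun i ↦ ?_⟩
  have := Finset.single_le_sum (f := fun i ↦ |u i| / v i)
    (fun i _ ↦ div_nonneg (abs_nonneg _) (hv i).le) (Finset.mem_univ i)
  calc u i ≤ |u i| := le_abs_self _
    _ = |u i| / v i * v i := by field_simp [(hv i).ne']
    _ ≤ _ := mul_le_mul_of_nonneg_right this (hv i).le

/-! ### Contraction in `L²` -/

lemma inner_const_one (F : L2 μ) : inner ℝ (Lp.const 2 μ (1 : ℝ)) F = ∫ x, F x ∂μ := by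
  rw [L2.inner_def]
  refine integral_congr_ae ?_
  filter_upwards [Lp.coeFn_const (p := 2) (μ := μ) (1 : ℝ)] with x hx
  rw [hx]; simp

lemma norm_const_one : ‖Lp.const 2 μ (1 : ℝ)‖ = 1 := by
  refine (Lp.norm_const' 2 μ (1 : ℝ) (by simp) (by simp)).trans ?_
  simp

lemma norm_sub_inner_const_le (F : L2 μ) :
    ‖F - (inner ℝ (Lp.const 2 μ (1 : ℝ)) F : ℝ) • Lp.const 2 μ (1 : ℝ)‖ ≤ ‖F‖ := by
  have h : ‖F - (inner ℝ (Lp.const 2 μ (1 : ℝ)) F : ℝ) • Lp.const 2 μ (1 : ℝ)‖ ^ 2 ≤ ‖F‖ ^ 2 := by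
    rw [@norm_sub_sq_real, inner_smul_right, norm_smul, norm_const_one, real_inner_comm,
      Real.norm_eq_abs, mul_one, sq_abs, real_inner_comm]
    nlinarith [sq_nonneg (inner ℝ (Lp.const 2 μ (1 : ℝ)) F)]
  exact le_of_sq_le_sq h (norm_nonneg _)

lemma norm_le_norm_sub_const {F : L2 μ} (h : inner ℝ (Lp.const 2 μ (1 : ℝ)) F = 0) (r : ℝ) :
    ‖F‖ ≤ ‖F - r • Lp.const 2 μ (1 : ℝ)‖ := by
  have := norm_sub_inner_const_le (F - r • Lp.const 2 μ (1 : ℝ))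
  rw [inner_sub_right, h, inner_smul_right, real_inner_self_eq_norm_sq, norm_const_one] at this
  simpa using this

/-- A mean-zero function has the smallest norm among its shifts by constants, so `f` may be compared
with its value at `c`, where the Lipschitz bound applies. -/
lemma CoordLipschitz.norm_le {c : Fin m → ℝ} (hξ : ∀ i, ξ i =ᵐ[μ] fun x ↦ x i - c i) {F : L2 μ}
    {f : (Fin m → ℝ) → ℝ} {a : Fin m → ℝ} (hF : F =ᵐ[μ] f) (hf : CoordLipschitz f a)
    (h0 : inner ℝ (Lp.const 2 μ (1 : ℝ)) F = 0) : ‖F‖ ≤ ∑ i, a i * ‖ξ i‖ := by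
  have h1 : ‖F - f c • Lp.const 2 μ (1 : ℝ)‖ ≤ ‖∑ i, a i • |ξ i|‖ := by
    refine Lp.norm_le_norm_of_ae_le ?_
    have e1 : ∀ᵐ x ∂μ, ∀ i, ξ i x = x i - c i := ae_all_iff.2 hξ
    have e2 : ∀ᵐ x ∂μ, ∀ i, (a i • |ξ i| : L2 μ) x = a i * |ξ i| x :=
      ae_all_iff.2 fun j ↦ Lp.coeFn_smul _ _
    have e3 : ∀ᵐ x ∂μ, ∀ i, |ξ i| x = |ξ i x| := ae_all_iff.2 fun j ↦ Lp.coeFn_abs _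
    filter_upwards [hF, e1, e2, e3, Lp.coeFn_fun_finsetSum Finset.univ fun i ↦ a i • |ξ i|,
      Lp.coeFn_sub F (f c • Lp.const 2 μ (1 : ℝ)), Lp.coeFn_smul (f c) (Lp.const 2 μ (1 : ℝ)),
      Lp.coeFn_const (p := 2) (μ := μ) (1 : ℝ)] with x hx h1 h2 h3 h4 h5 h6 h7
    rw [h4, h5, Pi.sub_apply, h6, Pi.smul_apply, h7, hx]
    simp only [h2, h3, h1, Function.const_apply, smul_eq_mul, mul_one, Real.norm_eq_abs]
    exact (hf.2 x c).trans (le_abs_self _)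
  refine (norm_le_norm_sub_const h0 _).trans (h1.trans ((norm_sum_le _ _).trans ?_))
  refine Finset.sum_le_sum fun i _ ↦ ?_
  rw [norm_smul, norm_abs_eq_norm, Real.norm_eq_abs, abs_of_nonneg (hf.1 i)]

/-- By symmetry and Cauchy–Schwarz, `‖S y‖² ≤ ‖y‖ ‖S (S y)‖`, so the ratios of successive norms
along the orbit of `x` never decrease. If the first one exceeded `q`, the orbit would outgrow `C * q
^ k`. The point is that `C`, which may depend on `x` in an uncontrolled way, disappears. -/
lemma norm_apply_le_of_norm_pow_le {E : Type*} [NormedAddCommGroup E] [InnerProductSpace ℝ E]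
    {S : E →L[ℝ] E} (hS : ∀ x y, inner ℝ (S x) y = inner ℝ x (S y)) {x : E} {C q : ℝ}
    (hq : 0 ≤ q) (h : ∀ k : ℕ, ‖(S ^ k) x‖ ≤ C * q ^ k) : ‖S x‖ ≤ q * ‖x‖ := by
  have hstep : ∀ y, ‖S y‖ ^ 2 ≤ ‖y‖ * ‖S (S y)‖ := fun y ↦ by
    rw [← real_inner_self_eq_norm_sq, hS]
    exact real_inner_le_norm _ _
  by_contra! hlt
  have hx : 0 < ‖x‖ := by
    rcases eq_or_ne x 0 with rfl | hx
    · simp at hlt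
    · exact norm_pos_iff.2 hx
  set t := ‖S x‖ / ‖x‖ with ht
  have hqt : q < t := by rwa [ht, lt_div_iff₀ hx]
  have ht0 : 0 < t := hq.trans_lt hqt
  have hgrow : ∀ k : ℕ, 0 < ‖(S ^ k) x‖ ∧ t * ‖(S ^ k) x‖ ≤ ‖(S ^ (k + 1)) x‖ := by
    intro k
    induction k with
    | zero => exact ⟨by simpa using hx, by simp [ht, hx.ne']⟩
    | succ k ih =>
      have hpos : 0 < ‖(S ^ (k + 1)) x‖ := (mul_pos ht0 ih.1).trans_le ih.2
      refine ⟨hpos, ?_⟩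
      have := hstep ((S ^ k) x)
      rw [← mul_apply_eq_comp, ← pow_succ', ← mul_apply_eq_comp,
        ← pow_succ'] at this
      have h3 : t * ‖(S ^ k) x‖ * ‖(S ^ (k + 1)) x‖ ≤ ‖(S ^ k) x‖ * ‖(S ^ (k + 1 + 1)) x‖ :=
        (mul_le_mul_of_nonneg_right ih.2 hpos.le).trans (by nlinarith)
      nlinarith [ih.1]
  have hlow : ∀ k : ℕ, t ^ k * ‖x‖ ≤ ‖(S ^ k) x‖ := by
    intro k
    induction k with
    | zero => simp
    | succ k ih =>
      calc _ = t * (t ^ k * ‖x‖) := by ring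
        _ ≤ t * ‖(S ^ k) x‖ := by gcongr
        _ ≤ _ := (hgrow k).2
  have hC : ∀ k : ℕ, ‖x‖ ≤ C * (q / t) ^ k := fun k ↦ by
    rw [div_pow, mul_div_assoc', le_div_iff₀ (pow_pos ht0 k), mul_comm]
    exact (hlow k).trans (h k)
  have hlim : Filter.Tendsto (fun k : ℕ ↦ C * (q / t) ^ k) Filter.atTop (nhds (C * 0)) :=
    (tendsto_pow_atTop_nhds_zero_of_lt_one (div_nonneg hq ht0.le)
      ((div_lt_one ht0).2 hqt)).const_mul C
  have := ge_of_tendsto' hlim hC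
  linarith

lemma coordLipschitz_of_hasCompactSupport {g : (Fin m → ℝ) → ℝ} (h1 : HasCompactSupport g)
    (h2 : ContDiff ℝ (⊤ : ℕ∞) g) (r : ℝ) : ∃ a, CoordLipschitz (fun x ↦ g x - r) a := by
  obtain ⟨K, hK⟩ := h2.lipschitzWith_of_hasCompactSupport h1 (by simp)
  refine ⟨fun _ ↦ K, fun _ ↦ K.2, fun x y ↦ ?_⟩
  rw [sub_sub_sub_cancel_right, ← Real.dist_eq, ← Finset.mul_sum]
  refine (hK.dist_le_mul x y).trans (mul_le_mul_of_nonneg_left ?_ K.2)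
  rw [dist_pi_le_iff (Finset.sum_nonneg fun i _ ↦ abs_nonneg _)]
  intro i
  rw [Real.dist_eq]
  exact Finset.single_le_sum (f := fun i ↦ |x i - y i|) (fun i _ ↦ abs_nonneg _)
    (Finset.mem_univ i)

-- Supersolutions for the matrices of both `T` and its adjoint control the self-adjoint operator
-- `(T*)ⁿ Tⁿ`. The resulting constant is uniform in `n` and `F`, although the Lipschitz constants of
-- `F` enter the intermediate estimates.
open ContinuousLinearMap in
theorem IsAffine.norm_pow_sub_le {c : Fin m → ℝ} (hξ : ∀ i, ξ i =ᵐ[μ] fun x ↦ x i - c i)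
    {B' : Matrix (Fin m) (Fin m) ℝ} (hT : IsAffine ξ T B) (hT' : IsAffine ξ (adjoint T) B')
    {u u' : Fin m → ℝ} (hu : ∀ i, 0 < u i) (hu' : ∀ i, 0 < u' i) {ρ : ℝ} (hρ : 0 ≤ ρ)
    (h : ∀ i, B.mulVec u i ≤ ρ * u i) (h' : ∀ i, B'.mulVec u' i ≤ ρ * u' i) :
    ∃ C, 0 ≤ C ∧ ∀ (n : ℕ) (F : L2 μ),
      ‖(T ^ n) F - (inner ℝ (Lp.const 2 μ (1 : ℝ)) F : ℝ) • Lp.const 2 μ (1 : ℝ)‖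
        ≤ C * ρ ^ n * ‖F‖ := by
  obtain ⟨D, hD, huD⟩ := exists_le_mul_of_pos u hu'
  obtain ⟨D', hD', huD'⟩ := exists_le_mul_of_pos u' hu
  obtain ⟨E, hE, hξE⟩ := exists_le_mul_of_pos (fun i ↦ ‖ξ i‖) hu'
  set e : L2 μ := Lp.const 2 μ (1 : ℝ) with he
  have hadj : ∀ n x y, inner ℝ ((adjoint T ^ n) x) y = inner ℝ x ((T ^ n) y) := by
    intro n
    induction n with
    | zero => simp
    | succ n ih =>
      intro x y
      rw [pow_succ, pow_succ', mul_apply_eq_comp, mul_apply_eq_comp, ih, adjoint_inner_left]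
  have key : ∀ (n : ℕ) (F : L2 μ) (f : (Fin m → ℝ) → ℝ) (a : Fin m → ℝ), F =ᵐ[μ] f →
      CoordLipschitz f a → inner ℝ e F = 0 → ‖(T ^ n) F‖ ≤ √(D * D') * ρ ^ n * ‖F‖ := by
    intro n F f a hF hf h0
    set S := adjoint T ^ n * T ^ n with hS
    set M := B ^ n * B' ^ n with hM
    have hSM : IsAffine ξ S M := (hT'.pow n).mul (hT.pow n)
    have hsym : ∀ x y, inner ℝ (S x) y = inner ℝ x (S y) := fun x y ↦ by
      rw [hS, mul_apply_eq_comp, mul_apply_eq_comp, hadj, real_inner_comm, ← hadj, real_inner_comm]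
    set q := D * D' * (ρ ^ n) ^ 2 with hq
    have hq0 : 0 ≤ q := by positivity
    -- `B' ^ n` contracts `u'` and `B ^ n` contracts `u`; passing from `u'` to `u` and back costs
    -- the factor `D * D'`, independent of `n`.
    have hMu : ∀ i, M.mulVec u' i ≤ q * u' i := by
      intro i
      rw [hM, ← Matrix.mulVec_mulVec]
      calc _ ≤ (B ^ n).mulVec (ρ ^ n • u') i :=
            mulVec_mono (pow_nonneg_apply hT.nonneg n) (pow_mulVec_le hT'.nonneg hρ h' n) i
        _ = ρ ^ n * (B ^ n).mulVec u' i := by rw [Matrix.mulVec_smul]; rfl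
        _ ≤ ρ ^ n * (B ^ n).mulVec (D' • u) i := by
            gcongr; exact mulVec_mono (pow_nonneg_apply hT.nonneg n) huD' i
        _ = ρ ^ n * D' * (B ^ n).mulVec u i := by
            rw [Matrix.mulVec_smul, Pi.smul_apply, smul_eq_mul, mul_assoc]
        _ ≤ ρ ^ n * D' * (ρ ^ n * u i) := by
            gcongr; exact pow_mulVec_le hT.nonneg hρ h n i
        _ ≤ ρ ^ n * D' * (ρ ^ n * (D * u' i)) := by gcongr; exact huD i
        _ = _ := by rw [hq]; ring
    have hSk : ∀ k : ℕ, ‖(S ^ k) F‖ ≤ (E * ∑ i, a i * u' i) * q ^ k := by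
      intro k
      obtain ⟨g, hg, hga⟩ := (hSM.pow k).lipschitz F f a hF hf
      have hmean : inner ℝ e ((S ^ k) F) = 0 := by
        have : ∀ k : ℕ, inner ℝ e ((S ^ k) F) = 0 := by
          intro k
          induction k with
          | zero => exact h0
          | succ k ih => rw [pow_succ', mul_apply_eq_comp, ← hsym, hSM.map_one]; exact ih
        exact this k
      refine (hga.norm_le hξ hg hmean).trans ?_
      calc _ ≤ ∑ i, (M ^ k).transpose.mulVec a i * (E * u' i) :=
            Finset.sum_le_sum fun i _ ↦ mul_le_mul_of_nonneg_left (hξE i) (hga.1 i)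
        _ = E * ((M ^ k).transpose.mulVec a ⬝ᵥ u') := by
            rw [dotProduct, Finset.mul_sum]; exact Finset.sum_congr rfl fun i _ ↦ by ring
        _ = E * (a ⬝ᵥ (M ^ k).mulVec u') := by
            rw [Matrix.mulVec_transpose, Matrix.dotProduct_mulVec]
        _ ≤ E * ∑ i, a i * (q ^ k * u' i) := by
            gcongr with i
            exact Finset.sum_le_sum fun i _ ↦
              mul_le_mul_of_nonneg_left (pow_mulVec_le hSM.nonneg hq0 hMu k i) (hf.1 i)
        _ = _ := by
            rw [mul_assoc, Finset.sum_mul]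
            congr 1; exact Finset.sum_congr rfl fun i _ ↦ by ring
    have hSF := norm_apply_le_of_norm_pow_le hsym hq0 hSk
    have hsq : ‖(T ^ n) F‖ ^ 2 ≤ (√(D * D') * ρ ^ n * ‖F‖) ^ 2 := by
      rw [← real_inner_self_eq_norm_sq, ← hadj, ← mul_apply_eq_comp, ← hS]
      refine (real_inner_le_norm _ _).trans ?_
      rw [mul_pow, mul_pow, Real.sq_sqrt (by positivity)]
      nlinarith [norm_nonneg F]
    exact le_of_sq_le_sq hsq (by positivity)
  refine ⟨√(D * D'), Real.sqrt_nonneg _, fun n F ↦ ?_⟩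
  -- The estimate is closed in `F` and its constant no longer sees Lipschitz data, so compactly
  -- supported smooth functions suffice.
  refine (Lp.dense_hasCompactSupport_contDiff (F := ℝ) (μ := μ) (p := 2) (by simp)).induction
    (P := fun F ↦ ‖(T ^ n) F - (inner ℝ e F : ℝ) • e‖ ≤ √(D * D') * ρ ^ n * ‖F‖) ?_ ?_ F
  · rintro F ⟨g, hg, hg1, hg2⟩
    obtain ⟨a, ha⟩ := coordLipschitz_of_hasCompactSupport hg1 hg2 (inner ℝ e F)
    have h1 : (T ^ n) F - (inner ℝ e F : ℝ) • e = (T ^ n) (F - (inner ℝ e F : ℝ) • e) := by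
      rw [map_sub, map_smul, (hT.pow n).map_one]
    rw [h1]
    refine (key n _ _ a ?_ ha ?_).trans
      (mul_le_mul_of_nonneg_left (norm_sub_inner_const_le F) (by positivity))
    · filter_upwards [hg, Lp.coeFn_sub F ((inner ℝ e F : ℝ) • e),
        Lp.coeFn_smul (inner ℝ e F : ℝ) e, Lp.coeFn_const (p := 2) (μ := μ) (1 : ℝ)]
        with x h1 h2 h3 h4
      rw [h2, Pi.sub_apply, h3, Pi.smul_apply, h4, h1]; simp
    · rw [inner_sub_right, inner_smul_right, real_inner_self_eq_norm_sq, he, norm_const_one]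
      simp
  · exact isClosed_le (by fun_prop) (by fun_prop)

end

/-! ### Transition kernels and their operators on `L²` -/

/-- The kernel `K` leaves `μ` invariant, and acts on `L²(μ)` as the operator `T`. -/
structure Represents {m : ℕ} {μ : Measure (Fin m → ℝ)}
    (K : Kernel (Fin m → ℝ) (Fin m → ℝ)) (T : L2 μ →L[ℝ] L2 μ) : Prop where
  markov : IsMarkovKernel K
  invariant : K ∘ₘ μ = μ
  integral : ∀ F : L2 μ, ∀ᵐ x ∂μ, ∫ y, F y ∂(K x) = T F x

section
variable {m : ℕ} {μ : Measure (Fin m → ℝ)} {K K₁ K₂ : Kernel (Fin m → ℝ) (Fin m → ℝ)}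
  {T T₁ T₂ : L2 μ →L[ℝ] L2 μ}

/-- Invariance is what lets `K` act on classes of functions: a `μ`-null set is `K x`-null for almost
every `x`. -/
lemma Represents.ae_ae (h : Represents K T) {p : (Fin m → ℝ) → Prop} (hp : ∀ᵐ x ∂μ, p x) :
    ∀ᵐ x ∂μ, ∀ᵐ y ∂(K x), p y :=
  Measure.ae_ae_of_ae_comp (by rwa [h.invariant])

lemma Represents.ae_integrable (h : Represents K T) {f : (Fin m → ℝ) → ℝ} (hf : Integrable f μ) :
    ∀ᵐ x ∂μ, Integrable f (K x) := by
  have : Integrable f (K ∘ₘ μ) := by rwa [h.invariant]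
  exact ((Measure.integrable_comp_iff this.1).1 this).1

lemma Represents.one : Represents (μ := μ) (1 : Kernel (Fin m → ℝ) (Fin m → ℝ)) 1 where
  markov := inferInstanceAs (IsMarkovKernel Kernel.id)
  invariant := Measure.id_comp
  integral F := by
    refine .of_forall fun x ↦ ?_
    change ∫ y, F y ∂(Kernel.id x) = F x
    rw [Kernel.id_apply]
    exact integral_dirac' _ _ (Lp.stronglyMeasurable F)

variable [IsProbabilityMeasure μ]

lemma integrable_coeFn (F : L2 μ) : Integrable F μ :=
  (Lp.memLp F).integrable (by norm_num)

/-- The order reverses: the later kernel is integrated first, so its operator is applied first to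
the function. -/
lemma Represents.mul (h₁ : Represents K₁ T₁) (h₂ : Represents K₂ T₂) :
    Represents (K₂ * K₁) (T₁ * T₂) := by
  have := h₁.markov
  have := h₂.markov
  have hinv : (K₂ ∘ₖ K₁) ∘ₘ μ = μ := by
    rw [← Measure.comp_assoc, h₁.invariant, h₂.invariant]
  refine ⟨inferInstanceAs (IsMarkovKernel (K₂ ∘ₖ K₁)), hinv, fun F ↦ ?_⟩
  have hint : ∀ᵐ x ∂μ, Integrable F ((K₂ ∘ₖ K₁) x) := by
    have : Integrable F ((K₂ ∘ₖ K₁) ∘ₘ μ) := by rw [hinv]; exact integrable_coeFn F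
    exact ((Measure.integrable_comp_iff this.1).1 this).1
  filter_upwards [hint, h₁.ae_ae (h₂.integral F), h₁.integral (T₂ F)] with x hx1 hx2 hx3
  change ∫ y, F y ∂((K₂ ∘ₖ K₁) x) = _
  rw [Kernel.integral_comp hx1, integral_congr_ae hx2, hx3]
  rfl

lemma Represents.pow (h : Represents K T) (n : ℕ) : Represents (K ^ n) (T ^ n) := by
  induction n with
  | zero => exact Represents.one
  | succ n ih => rw [pow_succ, pow_succ']; exact h.mul ih

lemma Represents.sum {ι : Type*} [Fintype ι] {K : ι → Kernel (Fin m → ℝ) (Fin m → ℝ)}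
    {T : ι → L2 μ →L[ℝ] L2 μ} {q : PMF ι} {M : Kernel (Fin m → ℝ) (Fin m → ℝ)}
    (hM : ∀ x, M x = ∑ j, q j • K j x) (h : ∀ j, Represents (K j) (T j)) :
    Represents M (∑ j, (q j).toReal • T j) := by
  have := fun j ↦ (h j).markov
  have hq : ∑ j, q j = 1 := by
    rw [← tsum_fintype (L := SummationFilter.unconditional _)]
    exact q.tsum_coe
  have hMk : IsMarkovKernel M := ⟨fun x ↦ ⟨by simp [hM, hq]⟩⟩
  refine ⟨hMk, ?_, fun F ↦ ?_⟩
  · ext s hs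
    rw [Measure.bind_apply hs M.aemeasurable]
    simp only [hM, Measure.coe_finsetSum, Finset.sum_apply, Measure.smul_apply, smul_eq_mul]
    rw [lintegral_finsetSum _ fun j _ ↦ ((K j).measurable_coe hs).const_mul _]
    have hj : ∀ j, ∫⁻ x, q j * K j x s ∂μ = q j * μ s := fun j ↦ by
      rw [lintegral_const_mul _ ((K j).measurable_coe hs),
        ← Measure.bind_apply hs (K j).aemeasurable, (h j).invariant]
    simp_rw [hj, ← Finset.sum_mul, hq, one_mul]
  · have h1 : ∀ᵐ x ∂μ, ∀ j, Integrable F (K j x) :=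
      ae_all_iff.2 fun j ↦ (h j).ae_integrable (integrable_coeFn F)
    have h2 : ∀ᵐ x ∂μ, ∀ j, ∫ y, F y ∂(K j x) = T j F x := ae_all_iff.2 fun j ↦ (h j).integral F
    have h3 : ∀ᵐ x ∂μ, ∀ j, ((q j).toReal • T j F : L2 μ) x = (q j).toReal * T j F x :=
      ae_all_iff.2 fun j ↦ Lp.coeFn_smul _ _
    filter_upwards [h1, h2, h3,
      Lp.coeFn_fun_finsetSum Finset.univ fun j ↦ ((q j).toReal • T j) F] with x hx1 hx2 hx3 hx4
    rw [hM, integral_finsetSum_measure fun j _ ↦ (hx1 j).smul_measure (q.apply_ne_top j),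
      sum_apply, hx4]
    refine Finset.sum_congr rfl fun j _ ↦ ?_
    rw [integral_smul_measure, hx2, smul_apply, hx3, smul_eq_mul]

end

/-! ### From operator bounds to convergence rates -/

section
variable {m : ℕ} {G : ProbabilityMeasure (Fin m → ℝ)}
  {K : Kernel (Fin m → ℝ) (Fin m → ℝ)}
  {T : L2 (G : Measure (Fin m → ℝ)) →L[ℝ] L2 (G : Measure (Fin m → ℝ))}
  {ξ : Fin m → L2 (G : Measure (Fin m → ℝ))} {B : Matrix (Fin m) (Fin m) ℝ}

lemma Represents.eLpNorm_eq (h : Represents K T) {f : (Fin m → ℝ) → ℝ}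
    (hf : MemLp f 2 (G : Measure (Fin m → ℝ))) (n : ℕ) :
    eLpNorm (fun x ↦ ∫ y, f y ∂((K ^ n) x) - ∫ y, f y ∂(G : Measure (Fin m → ℝ))) 2
      (G : Measure (Fin m → ℝ)) = ENNReal.ofReal ‖(T ^ n) hf.toLp -
        (inner ℝ (Lp.const 2 (G : Measure (Fin m → ℝ)) (1 : ℝ)) hf.toLp : ℝ) •
          Lp.const 2 (G : Measure (Fin m → ℝ)) (1 : ℝ)‖ := by
  rw [ofReal_norm, Lp.enorm_def]
  refine eLpNorm_congr_ae ?_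
  set F := hf.toLp with hF
  have hfF : ∀ᵐ x ∂(G : Measure (Fin m → ℝ)), F x = f x := hf.coeFn_toLp
  filter_upwards [(h.pow n).ae_ae hfF, (h.pow n).integral F,
    Lp.coeFn_sub ((T ^ n) F) ((inner ℝ (Lp.const 2 (G : Measure (Fin m → ℝ)) (1 : ℝ)) F : ℝ) •
      Lp.const 2 (G : Measure (Fin m → ℝ)) (1 : ℝ)),
    Lp.coeFn_smul (inner ℝ (Lp.const 2 (G : Measure (Fin m → ℝ)) (1 : ℝ)) F : ℝ)
      (Lp.const 2 (G : Measure (Fin m → ℝ)) (1 : ℝ)),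
    Lp.coeFn_const (p := 2) (μ := (G : Measure (Fin m → ℝ))) (1 : ℝ)] with x h1 h2 h3 h4 h5
  rw [h3, Pi.sub_apply, h4, Pi.smul_apply, h5, ← integral_congr_ae h1, h2, inner_const_one,
    integral_congr_ae hfF]
  simp

/-- The operator bound gives admissibility of `ρ`. For minimality, the left eigenvector `z` makes `∑
z i • ξ i` a nonzero, mean-zero eigenfunction of `T`, whose norm decays exactly like `ρ ^ n`. -/
theorem Represents.isL2Rate (h : Represents K T) (hT : IsAffine ξ T B)
    (hmean : ∀ i, inner ℝ (Lp.const 2 (G : Measure (Fin m → ℝ)) (1 : ℝ)) (ξ i) = 0)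
    (hli : LinearIndependent ℝ ξ) {ρ : ℝ} (hρ : 0 ≤ ρ)
    (hC : ∃ C, 0 ≤ C ∧ ∀ (n : ℕ) (F : L2 (G : Measure (Fin m → ℝ))),
      ‖(T ^ n) F - (inner ℝ (Lp.const 2 (G : Measure (Fin m → ℝ)) (1 : ℝ)) F : ℝ) •
        Lp.const 2 (G : Measure (Fin m → ℝ)) (1 : ℝ)‖ ≤ C * ρ ^ n * ‖F‖)
    (hz : ∃ z : Fin m → ℝ, z ≠ 0 ∧ Matrix.vecMul z B = ρ • z) : IsL2Rate K G ρ := by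
  obtain ⟨C, hC0, hC⟩ := hC
  refine ⟨⟨hρ, fun f hf r hr ↦ ⟨C * ‖hf.toLp‖ + 1, by positivity, fun n ↦ ?_⟩⟩, ?_⟩
  · rw [h.eLpNorm_eq hf]
    refine ENNReal.ofReal_le_ofReal ((hC n _).trans ?_)
    calc C * ρ ^ n * ‖hf.toLp‖ = C * ‖hf.toLp‖ * ρ ^ n := by ring
      _ ≤ (C * ‖hf.toLp‖ + 1) * r ^ n := by
        gcongr
        linarith
  · rintro ρ' ⟨hρ', hV⟩
    by_contra! hlt
    obtain ⟨z, hz0, hz⟩ := hz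
    set F := ∑ i, z i • ξ i with hF
    have hTF : T F = ρ • F := by
      rw [hF, map_sum, Finset.smul_sum]
      simp_rw [map_smul, hT.map_coord, Finset.smul_sum, smul_smul]
      rw [Finset.sum_comm]
      refine Finset.sum_congr rfl fun j _ ↦ ?_
      rw [← Finset.sum_smul]
      congr 1
      exact congrFun hz j
    have hTn : ∀ n : ℕ, (T ^ n) F = ρ ^ n • F := by
      intro n
      induction n with
      | zero => simp
      | succ n ih => rw [pow_succ, mul_apply_eq_comp, hTF, map_smul, ih, smul_smul, pow_succ']
    have hF0 : 0 < ‖F‖ := by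
      rw [norm_pos_iff]
      intro h0
      exact hz0 (funext (Fintype.linearIndependent_iff.1 hli z h0))
    have hFm : inner ℝ (Lp.const 2 (G : Measure (Fin m → ℝ)) (1 : ℝ)) F = 0 := by
      rw [hF, inner_sum]
      exact Finset.sum_eq_zero fun i _ ↦ by rw [inner_smul_right, hmean, mul_zero]
    obtain ⟨r, hr1, hr2⟩ := exists_between hlt
    have hr0 : 0 < r := hρ'.trans_lt hr1
    obtain ⟨V, hV0, hV⟩ := hV F (Lp.memLp F) r hr1
    have hbound : ∀ n : ℕ, ‖F‖ ≤ V * (r / ρ) ^ n := by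
      intro n
      have := hV n
      rw [h.eLpNorm_eq (Lp.memLp F), Lp.toLp_coeFn, hFm, zero_smul, sub_zero, hTn, norm_smul,
        ENNReal.ofReal_le_ofReal_iff (by positivity), Real.norm_of_nonneg (by positivity)] at this
      have hρ0 : 0 < ρ := hr0.trans hr2
      rw [div_pow, mul_div_assoc', le_div_iff₀ (pow_pos hρ0 n), mul_comm]
      exact this
    have hlim : Filter.Tendsto (fun k : ℕ ↦ V * (r / ρ) ^ k) Filter.atTop (nhds (V * 0)) :=
      (tendsto_pow_atTop_nhds_zero_of_lt_one (by positivity)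
        ((div_lt_one (hr0.trans hr2)).2 hr2)).const_mul V
    have := ge_of_tendsto' hlim hbound
    linarith

theorem Represents.isSweepMatrix (h : Represents K T) (hT : IsAffine ξ T B) {c : Fin m → ℝ}
    (hξ : ∀ i, ξ i =ᵐ[(G : Measure (Fin m → ℝ))] fun x ↦ x i - c i) : IsSweepMatrix K G B := by
  refine ⟨c - B.mulVec c, ?_⟩
  have h1 : ∀ᵐ x ∂(G : Measure (Fin m → ℝ)), ∀ i, ξ i x = x i - c i := ae_all_iff.2 hξ
  have h2 : ∀ᵐ x ∂(G : Measure (Fin m → ℝ)), ∀ i, Integrable (ξ i) (K x) :=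
    ae_all_iff.2 fun i ↦ h.ae_integrable (integrable_coeFn _)
  have h3 : ∀ᵐ x ∂(G : Measure (Fin m → ℝ)), ∀ i, ∫ y, ξ i y ∂(K x) = T (ξ i) x :=
    ae_all_iff.2 fun i ↦ h.integral _
  have h4 : ∀ᵐ x ∂(G : Measure (Fin m → ℝ)), ∀ i j, (B i j • ξ j : L2 _) x = B i j * ξ j x :=
    ae_all_iff.2 fun i ↦ ae_all_iff.2 fun j ↦ Lp.coeFn_smul _ _
  have h5 : ∀ᵐ x ∂(G : Measure (Fin m → ℝ)), ∀ i,
      (∑ j, B i j • ξ j : L2 _) x = ∑ j, (B i j • ξ j : L2 _) x :=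
    ae_all_iff.2 fun i ↦ Lp.coeFn_fun_finsetSum Finset.univ fun j ↦ B i j • ξ j
  filter_upwards [h1, h.ae_ae h1, h2, h3, h4, h5] with x hx1 hx1' hx2 hx3 hx4 hx5 i
  have := h.markov
  have hi : (ξ i) =ᵐ[K x] fun y ↦ y i - c i := by
    filter_upwards [hx1'] with y hy using hy i
  have hint : Integrable (fun y : Fin m → ℝ ↦ y i - c i) (K x) := (hx2 i).congr hi
  have hint' : Integrable (fun y : Fin m → ℝ ↦ y i) (K x) := by
    exact (hint.add (integrable_const (c i))).congr (.of_forall fun y ↦ by simp)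
  refine ⟨hint', ?_⟩
  have e1 : ∫ y, y i ∂(K x) - c i = ∫ y, ξ i y ∂(K x) := by
    rw [integral_congr_ae hi, integral_sub hint' (integrable_const _)]
    simp
  rw [hx3, hT.map_coord, hx5] at e1
  rw [sub_eq_iff_eq_add] at e1
  rw [e1]
  simp only [hx4, hx1, mul_sub, Finset.sum_sub_distrib, Matrix.mulVec, dotProduct, Pi.add_apply,
    Pi.sub_apply]
  ring

end

/-! ### Coordinate updates of a Gaussian law -/

/-- The Gaussian law `μ` with mean `c` is a conditional autoregression with coefficients `A`: the
residual of a coordinate, given its predictor by `A`, is uncorrelated with the other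
coordinates. -/
structure IsAutoregressive {m : ℕ} (μ : Measure (Fin m → ℝ)) (c : Fin m → ℝ)
    (A : Matrix (Fin m) (Fin m) ℝ) (κ : ℝ) : Prop where
  gaussian : IsGaussian μ
  mean : ∀ i, ∫ x, x i ∂μ = c i
  nonneg : ∀ i j, 0 ≤ A i j
  diag : ∀ i, A i i = 0
  pos : 0 < κ
  cov_sub : ∀ i j, cov[fun x ↦ x i, fun x ↦ x j; μ] -
    ∑ l, A i l * cov[fun x ↦ x l, fun x ↦ x j; μ] = if i = j then κ else 0

/-- The matrix of the update of the coordinates in `S`. -/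
def updateMatrix {m : ℕ} (A : Matrix (Fin m) (Fin m) ℝ) (S : Finset (Fin m)) :
    Matrix (Fin m) (Fin m) ℝ :=
  Matrix.of fun i j ↦ if i ∈ S then A i j else (1 : Matrix (Fin m) (Fin m) ℝ) i j

/-- The restriction of a vector to the coordinates outside of `S`. -/
def offRestrict {m : ℕ} (S : Finset (Fin m)) (x : Fin m → ℝ) (j : {j // j ∉ S}) : ℝ := x j

@[fun_prop]
lemma measurable_offRestrict {m : ℕ} (S : Finset (Fin m)) : Measurable (offRestrict S) := by
  unfold offRestrict; fun_prop

/-- The conditional expectation on `L²(μ)` given the coordinates outside of `S`. -/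
noncomputable def updateOp {m : ℕ} (μ : Measure (Fin m → ℝ)) (S : Finset (Fin m)) :
    L2 μ →L[ℝ] L2 μ :=
  (lpMeas ℝ ℝ (MeasurableSpace.comap (offRestrict S) inferInstance) 2 μ).subtypeL ∘L
    condExpL2 ℝ ℝ (measurable_offRestrict S).comap_le

section
variable {m : ℕ} {μ : Measure (Fin m → ℝ)} {c : Fin m → ℝ} {A : Matrix (Fin m) (Fin m) ℝ} {κ : ℝ}

lemma adjoint_updateOp (S : Finset (Fin m)) :
    ContinuousLinearMap.adjoint (updateOp μ S) = updateOp μ S := by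
  symm
  rw [ContinuousLinearMap.eq_adjoint_iff]
  intro x y
  exact inner_condExpL2_left_eq_right (measurable_offRestrict S).comap_le

lemma updateOp_ae_eq [IsProbabilityMeasure μ] (S : Finset (Fin m)) (F : L2 μ) :
    updateOp μ S F =ᵐ[μ] μ[F | MeasurableSpace.comap (offRestrict S) inferInstance] := by
  have := (Lp.memLp F).condExpL2_ae_eq_condExp (𝕜 := ℝ) (measurable_offRestrict S).comap_le
  rwa [Lp.toLp_coeFn] at this

lemma represents_gibbsUpdate (G : ProbabilityMeasure (Fin m → ℝ)) (S : Finset (Fin m)) :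
    Represents (gibbsUpdate G S) (updateOp (G : Measure (Fin m → ℝ)) S) where
  markov := by unfold gibbsUpdate; infer_instance
  invariant := by
    have h := condDistrib_comp_map (μ := (G : Measure (Fin m → ℝ))) (Y := id)
      (measurable_offRestrict S).aemeasurable aemeasurable_id
    rw [Measure.map_id] at h
    conv_rhs => rw [← h]
    ext s hs
    rw [Measure.bind_apply hs (Kernel.aemeasurable _), Measure.bind_apply hs (Kernel.aemeasurable _),
      lintegral_map (Kernel.measurable_coe _ hs) (measurable_offRestrict S)]
    rfl
  integral F := by
    filter_upwards [updateOp_ae_eq S F, condExp_ae_eq_integral_condDistrib_id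
      (measurable_offRestrict S) (integrable_coeFn F)] with x h1 h2
    rw [h1, h2]
    rfl

lemma CoordLipschitz.continuous {f : (Fin m → ℝ) → ℝ} {a : Fin m → ℝ} (hf : CoordLipschitz f a) :
    Continuous f := by
  refine (LipschitzWith.of_dist_le_mul (K := (∑ i, a i).toNNReal) fun x y ↦ ?_).continuous
  rw [Real.dist_eq, Real.coe_toNNReal _ (Finset.sum_nonneg fun i _ ↦ hf.1 i), Finset.sum_mul]
  exact (hf.2 x y).trans (Finset.sum_le_sum fun i _ ↦
    mul_le_mul_of_nonneg_left (dist_le_pi_dist x y i) (hf.1 i))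

lemma CoordLipschitz.integrable_comp [IsProbabilityMeasure μ] {f : (Fin m → ℝ) → ℝ}
    {a : Fin m → ℝ} (hf : CoordLipschitz f a) {Z : (Fin m → ℝ) → Fin m → ℝ} (hZm : Measurable Z)
    (hZ : ∀ i, Integrable (fun x ↦ Z x i) μ) : Integrable (fun x ↦ f (Z x)) μ := by
  have hint : Integrable (fun x ↦ |f 0| + ∑ i, a i * |Z x i|) μ :=
    (integrable_const _).add (integrable_finsetSum _ fun i _ ↦ (hZ i).abs.const_mul _)
  refine hint.mono' (hf.continuous.measurable.comp hZm).aestronglyMeasurable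
    (.of_forall fun x ↦ ?_)
  have := hf.2 (Z x) 0
  simp only [Pi.zero_apply, sub_zero] at this
  rw [Real.norm_eq_abs]
  have h2 := abs_sub_abs_le_abs_sub (f (Z x)) (f 0)
  linarith

/-- When `A` has no entries inside `S`, the columns of the update matrix indexed by `S` vanish: the
new state forgets the old values there. -/
lemma updateMatrix_mulVec_eq (S : Finset (Fin m)) (hS : ∀ i ∈ S, ∀ j ∈ S, A i j = 0)
    {x y : Fin m → ℝ} (h : ∀ j ∉ S, x j = y j) :
    (updateMatrix A S).mulVec x = (updateMatrix A S).mulVec y := by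
  ext i
  simp only [Matrix.mulVec, dotProduct]
  refine Finset.sum_congr rfl fun j _ ↦ ?_
  by_cases hj : j ∈ S
  · have : updateMatrix A S i j = 0 := by
      by_cases hi : i ∈ S
      · simp [updateMatrix, hi, hS i hi j hj]
      · have : i ≠ j := fun e ↦ hi (e ▸ hj)
        simp [updateMatrix, hi, this]
    simp [this]
  · rw [h j hj]

/-! ### Block updates of an autoregression as conditional expectations -/

namespace IsAutoregressive

lemma memLp (h : IsAutoregressive μ c A κ) (i : Fin m) : MemLp (fun x : Fin m → ℝ ↦ x i) 2 μ :=
  have := h.gaussian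
  (IsGaussian.hasGaussianLaw_id (μ := μ).eval i).memLp_two

lemma isProbabilityMeasure (h : IsAutoregressive μ c A κ) : IsProbabilityMeasure μ :=
  have := h.gaussian
  inferInstance

lemma integrable (h : IsAutoregressive μ c A κ) (i : Fin m) :
    Integrable (fun x : Fin m → ℝ ↦ x i) μ :=
  have := h.isProbabilityMeasure
  (h.memLp i).integrable (by norm_num)

lemma integrable_mulVec (h : IsAutoregressive μ c A κ) (M : Matrix (Fin m) (Fin m) ℝ)
    (i : Fin m) : Integrable (fun x ↦ M.mulVec x i) μ := by
  simp only [Matrix.mulVec, dotProduct]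
  exact integrable_finsetSum _ fun j _ ↦ (h.integrable j).const_mul _

lemma integral_mulVec (h : IsAutoregressive μ c A κ) (M : Matrix (Fin m) (Fin m) ℝ)
    (i : Fin m) : ∫ x, M.mulVec x i ∂μ = M.mulVec c i := by
  simp only [Matrix.mulVec, dotProduct]
  rw [integral_finsetSum _ fun j _ ↦ (h.integrable j).const_mul _]
  simp_rw [integral_const_mul, h.mean]

lemma memLp_sub (h : IsAutoregressive μ c A κ) (i : Fin m) :
    MemLp (fun x : Fin m → ℝ ↦ x i - c i) 2 μ :=
  have := h.isProbabilityMeasure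
  (h.memLp i).sub (memLp_const _)

/-- The centred coordinates in `L²(μ)`. -/
noncomputable def coord (h : IsAutoregressive μ c A κ) (i : Fin m) : L2 μ := (h.memLp_sub i).toLp

lemma coord_ae_eq (h : IsAutoregressive μ c A κ) (i : Fin m) :
    h.coord i =ᵐ[μ] fun x ↦ x i - c i := (h.memLp_sub i).coeFn_toLp

lemma inner_one_coord (h : IsAutoregressive μ c A κ) [IsProbabilityMeasure μ] (i : Fin m) :
    inner ℝ (Lp.const 2 μ (1 : ℝ)) (h.coord i) = 0 := by
  rw [inner_const_one, integral_congr_ae (h.coord_ae_eq i),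
    integral_sub (h.integrable i) (integrable_const _), h.mean]
  simp

lemma inner_coord (h : IsAutoregressive μ c A κ) (i j : Fin m) :
    inner ℝ (h.coord i) (h.coord j) = cov[fun x ↦ x i, fun x ↦ x j; μ] := by
  rw [L2.inner_def, covariance]
  refine integral_congr_ae ?_
  filter_upwards [h.coord_ae_eq i, h.coord_ae_eq j] with x hi hj
  rw [hi, hj, h.mean, h.mean]
  exact mul_comm _ _

/-- The covariance matrix of an autoregression. -/
lemma one_sub_mul_cov (h : IsAutoregressive μ c A κ) :
    (1 - A) * Matrix.of (fun i j : Fin m ↦ cov[fun x ↦ x i, fun x ↦ x j; μ]) = κ • 1 := by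
  ext i j
  rw [sub_mul, one_mul, Matrix.sub_apply, Matrix.mul_apply]
  simpa [Matrix.one_apply] using h.cov_sub i j

/-- The Gram matrix of the centred coordinates is the covariance matrix, which is invertible with
inverse `κ⁻¹ • (1 - A)`. -/
lemma linearIndependent_coord (h : IsAutoregressive μ c A κ) : LinearIndependent ℝ h.coord := by
  rw [Fintype.linearIndependent_iff]
  intro z hz
  set C := Matrix.of (fun i j : Fin m ↦ cov[fun x ↦ x i, fun x ↦ x j; μ]) with hC
  have h1 : Matrix.vecMul z C = 0 := by
    ext j
    have : inner ℝ (∑ i, z i • h.coord i) (h.coord j) = 0 := by rw [hz, inner_zero_left]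
    rw [sum_inner] at this
    simpa [Matrix.vecMul, dotProduct, real_inner_smul_left, h.inner_coord, hC] using this
  have h2 : C * (κ⁻¹ • (1 - A)) = 1 := by
    rw [mul_eq_one_comm, smul_mul_assoc, h.one_sub_mul_cov, smul_smul, inv_mul_cancel₀ h.pos.ne',
      one_smul]
  have h3 : z = 0 := by
    rw [← Matrix.vecMul_one z, ← h2, ← Matrix.vecMul_vecMul, h1, Matrix.zero_vecMul]
  exact fun i ↦ congrFun h3 i

/-- Rows of the residual outside `S` are zero, and those in `S` are uncorrelated with the kept
coordinates by `cov_sub`; joint Gaussianity turns this into independence. -/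
lemma indepFun_residual (h : IsAutoregressive μ c A κ) (S : Finset (Fin m)) :
    IndepFun (offRestrict S) (fun x ↦ (1 - updateMatrix A S).mulVec x) μ := by
  have := h.gaussian
  have hlin : HasGaussianLaw (fun x : Fin m → ℝ ↦
      ((fun j : {j // j ∉ S} ↦ x j), fun i ↦ (1 - updateMatrix A S).mulVec x i)) μ :=
    (IsGaussian.hasGaussianLaw_id (μ := μ)).map_fun
      ((ContinuousLinearMap.pi fun j : {j // j ∉ S} ↦
        ContinuousLinearMap.proj (R := ℝ) (φ := fun _ : Fin m ↦ ℝ) (j : Fin m)).prod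
      (LinearMap.toContinuousLinearMap (Matrix.mulVecLin (1 - updateMatrix A S))))
  refine hlin.indepFun_of_covariance_eval (X := fun (j : {j // j ∉ S}) x ↦ x j)
    (Y := fun i x ↦ (1 - updateMatrix A S).mulVec x i) fun j i ↦ ?_
  simp only [Matrix.mulVec, dotProduct]
  rw [covariance_fun_sum_right (fun l ↦ (h.memLp l).const_mul _) (h.memLp j)]
  simp_rw [covariance_const_mul_right]
  by_cases hi : i ∈ S
  · have hij : i ≠ j := fun e ↦ j.2 (e ▸ hi)
    have := h.cov_sub i j
    rw [if_neg hij] at this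
    rw [← this]
    simp only [updateMatrix, Matrix.sub_apply, Matrix.of_apply, if_pos hi, sub_mul,
      Finset.sum_sub_distrib, Matrix.one_apply, ite_mul, one_mul, zero_mul, Finset.sum_ite_eq,
      Finset.mem_univ, if_true]
    rw [covariance_comm]
    congr 1
    exact Finset.sum_congr rfl fun l _ ↦ by rw [covariance_comm]
  · exact Finset.sum_eq_zero fun l _ ↦ by simp [updateMatrix, hi]

/-- Write `x = B x + (1 - B) x` with `B` the update matrix. The first term depends only on the kept
coordinates and the second is independent of them, so conditioning freezes the first and integrates
out the second. -/
lemma updateOp_ae_eq_integral (h : IsAutoregressive μ c A κ) (S : Finset (Fin m))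
    (hS : ∀ i ∈ S, ∀ j ∈ S, A i j = 0) {F : L2 μ} {f : (Fin m → ℝ) → ℝ} {a : Fin m → ℝ}
    (hF : F =ᵐ[μ] f) (hf : CoordLipschitz f a) :
    updateOp μ S F =ᵐ[μ] fun x ↦
      ∫ y, f ((updateMatrix A S).mulVec x + (1 - updateMatrix A S).mulVec y) ∂μ := by
  have := h.isProbabilityMeasure
  set Y : (Fin m → ℝ) → Fin m → ℝ := fun x ↦ (1 - updateMatrix A S).mulVec x with hY
  have hYm : Measurable Y :=
    (LinearMap.toContinuousLinearMap (Matrix.mulVecLin (1 - updateMatrix A S))).measurable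
  -- The filler `0` is immaterial, since the update matrix ignores the coordinates in `S`.
  let ext : ({j // j ∉ S} → ℝ) → Fin m → ℝ := fun r j ↦ if hj : j ∉ S then r ⟨j, hj⟩ else 0
  have hext : Measurable ext := by
    refine measurable_pi_lambda _ fun j ↦ ?_
    by_cases hj : j ∉ S
    · simp only [ext, dif_pos hj]; fun_prop
    · simp only [ext, dif_neg hj]; fun_prop
  have hBm : Measurable fun x ↦ (updateMatrix A S).mulVec x :=
    (LinearMap.toContinuousLinearMap (Matrix.mulVecLin (updateMatrix A S))).measurable
  let k : ({j // j ∉ S} → ℝ) × (Fin m → ℝ) → ℝ := fun p ↦ f ((updateMatrix A S).mulVec (ext p.1) + p.2)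
  have hk : StronglyMeasurable k :=
    (hf.continuous.measurable.comp (((hBm.comp hext).comp measurable_fst).add
      measurable_snd)).stronglyMeasurable
  have hfill : ∀ x, (updateMatrix A S).mulVec (ext (offRestrict S x)) =
      (updateMatrix A S).mulVec x := fun x ↦
    updateMatrix_mulVec_eq S hS fun j hj ↦ by simp [ext, hj, offRestrict]
  have hkx : (fun x ↦ k (offRestrict S x, Y x)) = f := by
    ext x
    simp only [k, hfill, hY, Matrix.sub_mulVec, Matrix.one_mulVec, add_sub_cancel]
  have hfint : Integrable f μ := hf.integrable_comp measurable_id h.integrable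
  have hcond : condDistrib Y (offRestrict S) μ =ᵐ[μ.map (offRestrict S)]
      Kernel.const _ (μ.map Y) := by
    refine condDistrib_ae_eq_of_measure_eq_compProd _ hYm.aemeasurable ?_
    rw [Measure.compProd_const]
    exact (indepFun_iff_map_prod_eq_prod_map_map (measurable_offRestrict S).aemeasurable
      hYm.aemeasurable).1 (h.indepFun_residual S)
  have h1 := condExp_prod_ae_eq_integral_condDistrib (μ := μ) (measurable_offRestrict S)
    hYm.aemeasurable hk (by rwa [hkx])
  rw [hkx] at h1
  filter_upwards [updateOp_ae_eq S F, condExp_congr_ae (m := MeasurableSpace.comap (offRestrict S)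
    inferInstance) hF, h1, ae_of_ae_map (measurable_offRestrict S).aemeasurable hcond]
    with x e1 e2 e3 e4
  rw [e1, e2, e3, e4, Kernel.const_apply, integral_map hYm.aemeasurable]
  · simp only [k, hfill, hY]
  · exact (hk.comp_measurable measurable_prodMk_left).aestronglyMeasurable

theorem isAffine_updateOp (h : IsAutoregressive μ c A κ) [IsProbabilityMeasure μ]
    (S : Finset (Fin m)) (hS : ∀ i ∈ S, ∀ j ∈ S, A i j = 0) :
    IsAffine h.coord (updateOp μ S) (updateMatrix A S) := by
  have hnn : ∀ i j, 0 ≤ updateMatrix A S i j := fun i j ↦ by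
    simp only [updateMatrix, Matrix.of_apply, Matrix.one_apply]
    split_ifs
    exacts [h.nonneg i j, zero_le_one, le_rfl]
  have hYm : Measurable fun x ↦ (1 - updateMatrix A S).mulVec x :=
    (LinearMap.toContinuousLinearMap (Matrix.mulVecLin (1 - updateMatrix A S))).measurable
  refine ⟨hnn, ?_, fun i ↦ ?_, fun F f a hF hf ↦ ?_⟩
  · ext1
    have h1 : CoordLipschitz (m := m) (fun _ ↦ 1) 0 := ⟨fun _ ↦ le_rfl, fun _ _ ↦ by simp⟩
    filter_upwards [h.updateOp_ae_eq_integral S hS (Lp.coeFn_const (p := 2) (μ := μ) (1 : ℝ)) h1,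
      Lp.coeFn_const (p := 2) (μ := μ) (1 : ℝ)] with x e1 e2
    rw [e1, e2]
    simp
  · have h1 : CoordLipschitz (fun x : Fin m → ℝ ↦ x i - c i) (Pi.single i 1) := by
      refine ⟨fun j ↦ ?_, fun x y ↦ ?_⟩
      · by_cases hj : j = i
        · subst hj; simp
        · simp [hj]
      · simp [Pi.single_apply]
    ext1
    have e3 : ∀ᵐ x ∂μ, ∀ j, (updateMatrix A S i j • h.coord j : L2 μ) x =
        updateMatrix A S i j * h.coord j x := ae_all_iff.2 fun j ↦ Lp.coeFn_smul _ _
    filter_upwards [h.updateOp_ae_eq_integral S hS (h.coord_ae_eq i) h1, ae_all_iff.2 h.coord_ae_eq,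
      e3, Lp.coeFn_fun_finsetSum Finset.univ fun j ↦ updateMatrix A S i j • h.coord j]
      with x e1 e2 e3 e4
    rw [e1, e4]
    simp only [e3, e2, Pi.add_apply]
    have hi := h.integrable_mulVec (1 - updateMatrix A S) i
    rw [integral_sub (f := fun y ↦ _ + (1 - updateMatrix A S).mulVec y i)
      ((integrable_const _).add hi) (integrable_const _),
      integral_add (integrable_const _) hi, h.integral_mulVec]
    simp only [integral_const, probReal_univ, one_smul, Matrix.sub_mulVec, Matrix.one_mulVec,
      Pi.sub_apply, mul_sub, Finset.sum_sub_distrib]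
    simp only [Matrix.mulVec, dotProduct]
    ring
  · refine ⟨_, h.updateOp_ae_eq_integral S hS hF hf, fun i ↦ ?_, fun x x' ↦ ?_⟩
    · simp only [Matrix.mulVec, dotProduct]
      exact Finset.sum_nonneg fun j _ ↦ mul_nonneg (hnn j i) (hf.1 j)
    have hint : ∀ x, Integrable (fun y ↦ f ((updateMatrix A S).mulVec x +
        (1 - updateMatrix A S).mulVec y)) μ := fun x ↦
      hf.integrable_comp (measurable_const.add hYm) fun i ↦
        (integrable_const _).add (h.integrable_mulVec _ i)
    rw [← integral_sub (hint x) (hint x')]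
    -- Both starting points are coupled through the same noise `y`; the arguments then differ by `B
    -- (x - x')`, bounded entrywise by `B |x - x'|` because `B` is nonnegative.
    have hb : ∀ y, ‖f ((updateMatrix A S).mulVec x + (1 - updateMatrix A S).mulVec y) -
        f ((updateMatrix A S).mulVec x' + (1 - updateMatrix A S).mulVec y)‖ ≤
        ∑ i, (updateMatrix A S).transpose.mulVec a i * |x i - x' i| := fun y ↦ by
      refine (hf.2 _ _).trans ?_
      calc _ ≤ ∑ i, a i * ∑ j, updateMatrix A S i j * |x j - x' j| := by
            refine Finset.sum_le_sum fun i _ ↦ mul_le_mul_of_nonneg_left ?_ (hf.1 i)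
            simp only [Pi.add_apply, add_sub_add_right_eq_sub, Matrix.mulVec, dotProduct,
              ← Finset.sum_sub_distrib, ← mul_sub]
            refine (Finset.abs_sum_le_sum_abs _ _).trans (Finset.sum_le_sum fun j _ ↦ ?_)
            rw [abs_mul, abs_of_nonneg (hnn i j)]
        _ = _ := by
            simp only [Matrix.mulVec, dotProduct, Matrix.transpose_apply, Finset.mul_sum,
              Finset.sum_mul]
            rw [Finset.sum_comm]
            exact Finset.sum_congr rfl fun _ _ ↦ Finset.sum_congr rfl fun _ _ ↦ by ring
    simpa using norm_integral_le_of_norm_le_const (μ := μ) (.of_forall hb)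

end IsAutoregressive

end

/-! ### Perron eigenvectors -/

section
variable {m : ℕ} {B : Matrix (Fin m) (Fin m) ℝ} {u : Fin m → ℝ} {ρ : ℝ}

/-- A Collatz–Wielandt comparison: scale `u` until it dominates `w` and touches it at the index of
the largest ratio `w i / u i`, and compare the two images there. -/
lemma le_of_mul_le_mulVec (hB : ∀ i j, 0 ≤ B i j) (hu : ∀ i, 0 < u i)
    (h : B.mulVec u = ρ • u) {w : Fin m → ℝ} (hw : ∀ i, 0 ≤ w i) (hw0 : w ≠ 0) {t : ℝ}
    (ht : ∀ i, t * w i ≤ B.mulVec w i) : t ≤ ρ := by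
  obtain ⟨i₀, hi₀⟩ := Function.ne_iff.1 hw0
  obtain ⟨i, -, hi⟩ := Finset.exists_max_image Finset.univ (fun i ↦ w i / u i) ⟨i₀, Finset.mem_univ _⟩
  have hwi : 0 < w i / u i :=
    (div_pos (lt_of_le_of_ne (hw i₀) (Ne.symm hi₀)) (hu i₀)).trans_le (hi i₀ (Finset.mem_univ _))
  set M := w i / u i with hM
  have hwM : w i = M * u i := by rw [hM, div_mul_cancel₀ _ (hu i).ne']
  have h1 : B.mulVec w i ≤ B.mulVec (M • u) i :=
    mulVec_mono hB (fun j ↦ by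
      have := hi j (Finset.mem_univ j)
      rwa [div_le_iff₀ (hu j)] at this) i
  rw [Matrix.mulVec_smul, h] at h1
  have h2 := (ht i).trans h1
  simp only [Pi.smul_apply, smul_eq_mul] at h2
  rw [hwM] at h2
  have h3 : 0 < M * u i := mul_pos hwi (hu i)
  refine le_of_mul_le_mul_right ?_ h3
  linarith

lemma nonneg_of_mulVec_eq [NeZero m] (hB : ∀ i j, 0 ≤ B i j) (hu : ∀ i, 0 < u i)
    (h : B.mulVec u = ρ • u) : 0 ≤ ρ := by
  have h0 := congrFun h 0
  simp only [Matrix.mulVec, dotProduct, Pi.smul_apply, smul_eq_mul] at h0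
  have h1 : 0 ≤ ρ * u 0 := by
    rw [← h0]; exact Finset.sum_nonneg fun j _ ↦ mul_nonneg (hB _ _) (hu j).le
  exact nonneg_of_mul_nonneg_left h1 (hu 0)

/-- Entrywise moduli of a complex eigenvector satisfy `‖k‖ |v| ≤ B |v|`, to which
`le_of_mul_le_mulVec` applies; the positive eigenvector `u` attains the bound. -/
lemma hasSpectralRadius_of_mulVec_eq [NeZero m] (hB : ∀ i j, 0 ≤ B i j) (hu : ∀ i, 0 < u i)
    (h : B.mulVec u = ρ • u) : HasSpectralRadius B ρ := by
  have hρ := nonneg_of_mulVec_eq hB hu h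
  have hspec : ∀ k : ℂ, k ∈ spectrum ℂ (B.map ((↑) : ℝ → ℂ)) ↔
      Module.End.HasEigenvalue (Matrix.toLin' (B.map ((↑) : ℝ → ℂ))) k := fun k ↦ by
    rw [Module.End.hasEigenvalue_iff_mem_spectrum, Matrix.spectrum_toLin']
  refine ⟨hρ, le_antisymm (iSup₂_le fun k hk ↦ ?_) ?_⟩
  · obtain ⟨v, hv⟩ := ((hspec k).1 hk).exists_hasEigenvector
    have hkv : ∀ i, k * v i = ∑ j, (B i j : ℂ) * v j := fun i ↦ by
      have := congrFun hv.apply_eq_smul i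
      simpa [Matrix.mulVec, dotProduct] using this.symm
    have hle : ‖k‖ ≤ ρ := by
      refine le_of_mul_le_mulVec hB hu h (w := fun i ↦ ‖v i‖) (fun i ↦ norm_nonneg _) ?_ fun i ↦ ?_
      · intro h0
        exact hv.2 (funext fun i ↦ norm_eq_zero.1 (congrFun h0 i))
      · rw [← norm_mul, hkv]
        refine (norm_sum_le _ _).trans_eq ?_
        simp only [Matrix.mulVec, dotProduct]
        refine Finset.sum_congr rfl fun j _ ↦ ?_
        rw [norm_mul, Complex.norm_real, Real.norm_of_nonneg (hB i j)]
    rw [← ENNReal.ofReal_coe_nnreal, coe_nnnorm]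
    exact ENNReal.ofReal_le_ofReal hle
  · have hmem : (ρ : ℂ) ∈ spectrum ℂ (B.map ((↑) : ℝ → ℂ)) := by
      rw [hspec]
      refine Module.End.hasEigenvalue_of_hasEigenvector (x := fun i ↦ (u i : ℂ)) ⟨?_, ?_⟩
      · rw [Module.End.mem_eigenspace_iff]
        ext i
        have := congrFun h i
        simp only [Matrix.mulVec, dotProduct, Pi.smul_apply, smul_eq_mul] at this
        simp only [Matrix.toLin'_apply, Matrix.mulVec, dotProduct, Matrix.map_apply, Pi.smul_apply,
          smul_eq_mul]
        exact_mod_cast this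
      · intro h0
        exact (hu 0).ne' (by simpa using congrFun h0 0)
    refine le_trans (le_of_eq ?_) (le_iSup₂ (f := fun k _ ↦ (‖k‖₊ : ℝ≥0∞)) (ρ : ℂ) hmem)
    rw [← ENNReal.ofReal_coe_nnreal, coe_nnnorm, Complex.norm_real, Real.norm_of_nonneg hρ]

lemma isGreatest_eigenvalue_of_mulVec_eq [NeZero m] (hB : ∀ i j, 0 ≤ B i j) (hu : ∀ i, 0 < u i)
    (h : B.mulVec u = ρ • u) :
    IsGreatest {μ | Module.End.HasEigenvalue (Matrix.toLin' B) μ} ρ := by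
  refine ⟨Module.End.hasEigenvalue_of_hasEigenvector (x := u) ⟨?_, ?_⟩, fun k hk ↦ ?_⟩
  · rw [Module.End.mem_eigenspace_iff, Matrix.toLin'_apply, h]
  · intro h0
    exact (hu 0).ne' (congrFun h0 0)
  · obtain ⟨v, hv⟩ := Module.End.HasEigenvalue.exists_hasEigenvector hk
    refine (le_abs_self k).trans (le_of_mul_le_mulVec hB hu h (w := fun i ↦ |v i|)
      (fun i ↦ abs_nonneg _) ?_ fun i ↦ ?_)
    · intro h0
      exact hv.2 (funext fun i ↦ abs_eq_zero.1 (congrFun h0 i))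
    · have := congrFun hv.apply_eq_smul i
      simp only [Matrix.toLin'_apply, Pi.smul_apply, smul_eq_mul] at this
      rw [← abs_mul, ← this]
      simp only [Matrix.mulVec, dotProduct]
      refine (Finset.abs_sum_le_sum_abs _ _).trans_eq (Finset.sum_congr rfl fun j _ ↦ ?_)
      rw [abs_mul, abs_of_nonneg (hB i j)]

lemma exists_vecMul_eq_smul [NeZero m] (hu : ∀ i, 0 < u i) (h : B.mulVec u = ρ • u) :
    ∃ z : Fin m → ℝ, z ≠ 0 ∧ Matrix.vecMul z B = ρ • z := by
  have hdet : (B - ρ • (1 : Matrix (Fin m) (Fin m) ℝ)).det = 0 := by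
    refine Matrix.exists_mulVec_eq_zero_iff.1 ⟨u, fun h0 ↦ (hu 0).ne' (congrFun h0 0), ?_⟩
    rw [Matrix.sub_mulVec, h, Matrix.smul_mulVec, Matrix.one_mulVec, sub_self]
  obtain ⟨z, hz, hz'⟩ := Matrix.exists_vecMul_eq_zero_iff.2 hdet
  refine ⟨z, hz, ?_⟩
  rw [Matrix.vecMul_sub, Matrix.vecMul_smul, Matrix.vecMul_one, sub_eq_zero] at hz'
  exact hz'

/-! ### Sweeps -/

/-- The blocks of the level sets of `l`. -/
def levelBlocks {k : ℕ} (l : Fin m → Fin k) (a : Fin k) : Finset (Fin m) :=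
  Finset.univ.filter fun i ↦ l i = a

lemma updateMatrix_mulVec (A : Matrix (Fin m) (Fin m) ℝ) (S : Finset (Fin m)) (v : Fin m → ℝ)
    (i : Fin m) : (updateMatrix A S).mulVec v i = if i ∈ S then A.mulVec v i else v i := by
  by_cases hi : i ∈ S
  · simp [updateMatrix, Matrix.mulVec, dotProduct, hi]
  · simp [updateMatrix, Matrix.mulVec, dotProduct, hi, Matrix.one_apply]

/-- If neighbours lie in consecutive blocks, then a sweep over the blocks contracts a suitable
rescaling of an eigenvector of the autoregression by the square of the eigenvalue. -/
lemma sweep_mulVec {k : ℕ} {A : Matrix (Fin m) (Fin m) ℝ} {l : Fin m → Fin k}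
    (hl : ∀ i j, A i j ≠ 0 → (l i : ℕ) + 1 = l j ∨ (l j : ℕ) + 1 = l i) {s : Fin m → ℝ} {γ : ℝ}
    (hs : A.mulVec s = γ • s) :
    ((List.finRange k).map fun a ↦ updateMatrix A (levelBlocks l a)).reverse.prod.mulVec
      (fun i ↦ γ ^ (l i : ℕ) * s i) = γ ^ 2 • fun i ↦ γ ^ (l i : ℕ) * s i := by
  -- After `n` blocks, exactly the levels below `n` carry the extra factor `γ ^ 2`. A site of level
  -- `n` then sees the weight `γ ^ (n + 1)` at all its neighbours: those of level `n - 1` have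
  -- already been updated, those of level `n + 1` not yet.
  have key : ∀ n ≤ k,
      (((List.finRange k).take n).map fun a ↦ updateMatrix A (levelBlocks l a)).reverse.prod.mulVec
        (fun i ↦ γ ^ (l i : ℕ) * s i) =
      fun i ↦ if (l i : ℕ) < n then γ ^ 2 * (γ ^ (l i : ℕ) * s i) else γ ^ (l i : ℕ) * s i := by
    intro n
    induction n with
    | zero => simp
    | succ n ih =>
      intro hn
      have hlen : n < (List.finRange k).length := by simpa using hn
      rw [← List.take_append_getElem hlen, List.map_append, List.reverse_append,
        List.prod_append, ← Matrix.mulVec_mulVec, ih (by omega)]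
      simp only [List.getElem_finRange, Fin.cast_mk, List.map_cons, List.map_nil,
        List.reverse_singleton, List.prod_singleton]
      ext i
      rw [updateMatrix_mulVec]
      simp only [levelBlocks, Finset.mem_filter, Finset.mem_univ, true_and, Fin.ext_iff]
      by_cases hi : (l i : ℕ) = n
      · rw [if_pos hi, if_pos (by omega)]
        have hsi := congrFun hs i
        simp only [Matrix.mulVec, dotProduct, Pi.smul_apply, smul_eq_mul] at hsi ⊢
        calc _ = ∑ j, γ ^ (n + 1) * (A i j * s j) := by
              refine Finset.sum_congr rfl fun j _ ↦ ?_
              by_cases hA : A i j = 0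
              · simp [hA]
              rcases hl i j hA with h | h
              · rw [if_neg (by omega), ← h, hi]; ring
              · rw [if_pos (by omega), ← hi, ← h]; ring
          _ = _ := by rw [← Finset.mul_sum, hsi, hi]; ring
      · rw [if_neg hi]
        by_cases h2 : (l i : ℕ) < n
        · rw [if_pos h2, if_pos (by omega)]
        · rw [if_neg h2, if_neg (by omega)]
  have hk := key k le_rfl
  rw [List.take_of_length_le (by simp)] at hk
  rw [hk]
  ext i
  simp

lemma isAffine_list_prod {μ : Measure (Fin m → ℝ)} [IsProbabilityMeasure μ] {ξ : Fin m → L2 μ}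
    {ι : Type*} {T : ι → L2 μ →L[ℝ] L2 μ} {B : ι → Matrix (Fin m) (Fin m) ℝ}
    (h : ∀ i, IsAffine ξ (T i) (B i)) (l : List ι) :
    IsAffine ξ (l.map T).prod (l.map B).reverse.prod := by
  induction l with
  | nil => exact IsAffine.one
  | cons a l ih =>
    simp only [List.map_cons, List.prod_cons, List.reverse_cons, List.prod_append, List.prod_nil,
      mul_one]
    exact (h a).mul ih

lemma adjoint_list_prod {E : Type*} [NormedAddCommGroup E] [InnerProductSpace ℝ E]
    [CompleteSpace E] {ι : Type*} {T : ι → E →L[ℝ] E}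
    (h : ∀ i, ContinuousLinearMap.adjoint (T i) = T i) (l : List ι) :
    ContinuousLinearMap.adjoint (l.map T).prod = (l.reverse.map T).prod := by
  induction l with
  | nil => exact ContinuousLinearMap.adjoint_id
  | cons a l ih =>
    rw [List.map_cons, List.prod_cons, ContinuousLinearMap.mul_def, ContinuousLinearMap.adjoint_comp,
      ih, h, List.reverse_cons, List.map_append, List.prod_append]
    simp [ContinuousLinearMap.mul_def]

lemma represents_foldl {μ : Measure (Fin m → ℝ)} [IsProbabilityMeasure μ] {ι : Type*}
    {K : ι → Kernel (Fin m → ℝ) (Fin m → ℝ)} {T : ι → L2 μ →L[ℝ] L2 μ}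
    (h : ∀ i, Represents (K i) (T i)) (l : List ι) {K₀ : Kernel (Fin m → ℝ) (Fin m → ℝ)}
    {T₀ : L2 μ →L[ℝ] L2 μ} (h₀ : Represents K₀ T₀) :
    Represents (l.foldl (fun K' i ↦ K i ∘ₖ K') K₀) (T₀ * (l.map T).prod) := by
  induction l generalizing K₀ T₀ with
  | nil => simpa using h₀
  | cons a l ih =>
    rw [List.foldl_cons, List.map_cons, List.prod_cons, ← mul_assoc]
    exact ih (h₀.mul (h a))

lemma represents_sweep {k : ℕ} (G : ProbabilityMeasure (Fin m → ℝ)) (𝒜 : Fin k → Finset (Fin m))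
    (q : Fin k → PMF (Fin k)) :
    Represents (sweep G 𝒜 q) ((List.finRange k).map fun i ↦
      ∑ j, (q i j).toReal • updateOp (G : Measure (Fin m → ℝ)) (𝒜 j)).prod := by
  have := represents_foldl (K := fun i ↦ gibbsStep G 𝒜 (q i)) (fun i ↦ Represents.sum (q := q i)
    (M := gibbsStep G 𝒜 (q i)) (fun x ↦ rfl) fun j ↦ represents_gibbsUpdate G (𝒜 j))
    (List.finRange k) (Represents.one (μ := (G : Measure (Fin m → ℝ))))
  rwa [one_mul] at this

/-! ### Rates of the deterministic and random sweeps -/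

variable {G : ProbabilityMeasure (Fin m → ℝ)} {c : Fin m → ℝ} {A : Matrix (Fin m) (Fin m) ℝ}
  {κ : ℝ}

/-- The rate of convergence of the sweeps over blocks such that neighbours lie in consecutive
blocks. -/
theorem IsAutoregressive.isL2Rate_sweep [NeZero m]
    (hG : IsAutoregressive (G : Measure (Fin m → ℝ)) c A κ) {k : ℕ} {l : Fin m → Fin k}
    (hl : ∀ i j, A i j ≠ 0 → (l i : ℕ) + 1 = l j ∨ (l j : ℕ) + 1 = l i) {s : Fin m → ℝ}
    (hs : ∀ i, 0 < s i) {γ : ℝ} (hAs : A.mulVec s = γ • s) (hpos : ∀ i, 0 < γ ^ (l i : ℕ))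
    (hpos' : ∀ i, 0 < γ ^ (Fin.rev (l i) : ℕ)) :
    IsL2Rate (sweep G (levelBlocks l) PMF.pure) G (γ ^ 2) ∧
      ∃ B, IsSweepMatrix (sweep G (levelBlocks l) PMF.pure) G B ∧
        HasSpectralRadius B (γ ^ 2) := by
  have hstep : ∀ i : Fin k, ∑ j, (PMF.pure i j).toReal • updateOp (G : Measure (Fin m → ℝ)) (levelBlocks l j) =
      updateOp (G : Measure (Fin m → ℝ)) (levelBlocks l i) := fun i ↦ by
    rw [Finset.sum_eq_single i (fun j _ hj ↦ by simp [PMF.pure_apply, hj]) (by simp)]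
    simp
  have hrep := represents_sweep G (levelBlocks l) PMF.pure
  simp_rw [hstep] at hrep
  have haff : ∀ a, IsAffine hG.coord (updateOp (G : Measure (Fin m → ℝ)) (levelBlocks l a))
      (updateMatrix A (levelBlocks l a)) := fun a ↦ hG.isAffine_updateOp _ fun i hi j hj ↦ by
    simp only [levelBlocks, Finset.mem_filter, Finset.mem_univ, true_and] at hi hj
    by_contra hA
    have := hl i j hA
    rw [hi, hj] at this
    omega
  have hT := isAffine_list_prod haff (List.finRange k)
  have hT' := isAffine_list_prod haff (List.finRange k).reverse
  rw [← adjoint_list_prod (fun i ↦ adjoint_updateOp _)] at hT'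
  have hu := sweep_mulVec hl hAs
  have hl' : ∀ i j, A i j ≠ 0 → (Fin.rev (l i) : ℕ) + 1 = Fin.rev (l j) ∨
      (Fin.rev (l j) : ℕ) + 1 = Fin.rev (l i) := fun i j hA ↦ by
    have := hl i j hA
    simp only [Fin.val_rev]
    omega
  -- The adjoint visits the blocks backwards, which is a forward sweep for the reversed levels;
  -- these still place neighbours in consecutive blocks.
  have hu' := sweep_mulVec (l := fun i ↦ Fin.rev (l i)) hl' hAs
  have hrev : (List.finRange k).reverse.map (fun a ↦ updateMatrix A (levelBlocks l a)) =
      (List.finRange k).map fun a ↦ updateMatrix A (levelBlocks (fun i ↦ Fin.rev (l i)) a) := by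
    rw [List.finRange_reverse, List.map_map]
    refine List.map_congr_left fun a _ ↦ ?_
    simp only [Function.comp_apply, levelBlocks, Fin.rev_eq_iff]
  rw [← hrev] at hu'
  have hupos : ∀ i, 0 < γ ^ (l i : ℕ) * s i := fun i ↦ mul_pos (hpos i) (hs i)
  have hupos' : ∀ i, 0 < γ ^ (Fin.rev (l i) : ℕ) * s i := fun i ↦ mul_pos (hpos' i) (hs i)
  refine ⟨hrep.isL2Rate hT hG.inner_one_coord hG.linearIndependent_coord (sq_nonneg γ)
    (hT.norm_pow_sub_le hG.coord_ae_eq hT' hupos hupos' (sq_nonneg γ)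
      (fun i ↦ (congrFun hu i).le) fun i ↦ (congrFun hu' i).le) (exists_vecMul_eq_smul hupos hu),
    _, hrep.isSweepMatrix hT hG.coord_ae_eq, hasSpectralRadius_of_mulVec_eq hT.nonneg hupos hu⟩

lemma pow_mulVec_eq {B : Matrix (Fin m) (Fin m) ℝ} (h : B.mulVec u = ρ • u) (n : ℕ) :
    (B ^ n).mulVec u = ρ ^ n • u := by
  induction n with
  | zero => simp
  | succ n ih =>
    rw [pow_succ, ← Matrix.mulVec_mulVec, h, Matrix.mulVec_smul, ih, smul_smul, pow_succ']

/-- One averaged step is self-adjoint and maps `s i` to `γ * s i` with weight `1 / m` and to itself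
otherwise. So `s` is an eigenvector for the step and for its adjoint, and a sweep raises the
eigenvalue to the power `m`. -/
theorem IsAutoregressive.isL2Rate_randomSweep [NeZero m]
    (hG : IsAutoregressive (G : Measure (Fin m → ℝ)) c A κ) {s : Fin m → ℝ}
    (hs : ∀ i, 0 < s i) {γ : ℝ} (hAs : A.mulVec s = γ • s) :
    IsL2Rate (randomSweep G) G (((m - 1 + γ) / m) ^ m) := by
  have hm : (m : ℝ) ≠ 0 := Nat.cast_ne_zero.2 (NeZero.ne m)
  have haff : ∀ j : Fin m, IsAffine hG.coord (updateOp (G : Measure (Fin m → ℝ)) {j}) (updateMatrix A {j}) := fun j ↦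
    hG.isAffine_updateOp _ fun i hi i' hi' ↦ by
      rw [Finset.mem_singleton] at hi hi'
      rw [hi, hi', hG.diag]
  have hq : ∀ j : Fin m, (PMF.uniformOfFintype (Fin m) j).toReal = (m : ℝ)⁻¹ := fun j ↦ by simp
  have hrep := represents_sweep G (fun i : Fin m ↦ {i}) fun _ ↦ PMF.uniformOfFintype (Fin m)
  simp_rw [hq] at hrep
  rw [List.map_const', List.length_finRange, List.prod_replicate] at hrep
  have hS := IsAffine.sum (p := fun _ : Fin m ↦ (m : ℝ)⁻¹) (fun _ ↦ by positivity)
    (by simp [hm]) haff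
  have hadj : ContinuousLinearMap.adjoint (∑ j : Fin m, (m : ℝ)⁻¹ • updateOp (G : Measure (Fin m → ℝ)) {j}) =
      ∑ j : Fin m, (m : ℝ)⁻¹ • updateOp (G : Measure (Fin m → ℝ)) {j} := by
    rw [map_sum]
    refine Finset.sum_congr rfl fun j _ ↦ ?_
    rw [map_smulₛₗ, adjoint_updateOp]
    rfl
  have hT := hS.pow m
  have hT' : IsAffine hG.coord (ContinuousLinearMap.adjoint
      ((∑ j : Fin m, (m : ℝ)⁻¹ • updateOp (G : Measure (Fin m → ℝ)) {j}) ^ m))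
      ((∑ j : Fin m, (m : ℝ)⁻¹ • updateMatrix A {j}) ^ m) := by
    rw [← ContinuousLinearMap.star_eq_adjoint, star_pow, ContinuousLinearMap.star_eq_adjoint, hadj]
    exact hT
  have hu : (∑ j : Fin m, (m : ℝ)⁻¹ • updateMatrix A {j}).mulVec s = ((m - 1 + γ) / m) • s := by
    ext i
    rw [Matrix.sum_mulVec, Finset.sum_apply]
    simp_rw [Matrix.smul_mulVec, Pi.smul_apply, updateMatrix_mulVec, hAs, Finset.mem_singleton,
      Pi.smul_apply, smul_eq_mul]
    rw [← Finset.mul_sum]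
    have : ∀ j : Fin m, (if i = j then γ * s i else s i) = s i + if i = j then (γ - 1) * s i else 0 :=
      fun j ↦ by split_ifs <;> ring
    simp_rw [this, Finset.sum_add_distrib]
    simp only [Finset.sum_const, Finset.card_univ, Fintype.card_fin, nsmul_eq_mul,
      Finset.sum_ite_eq, Finset.mem_univ, if_true]
    field_simp
    ring
  have hu' := pow_mulVec_eq hu m
  have hρ := nonneg_of_mulVec_eq hT.nonneg hs hu'
  exact hrep.isL2Rate hT hG.inner_one_coord hG.linearIndependent_coord hρ
    (hT.norm_pow_sub_le hG.coord_ae_eq hT' hs hs hρ (fun i ↦ (congrFun hu' i).le)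
      fun i ↦ (congrFun hu' i).le) (exists_vecMul_eq_smul hs hu')

end

/-! ### The law of the Brownian bridge at the anchors -/

/-- The mean at the times `k` of the bridge from `x₀` to `z` on `[0, T]`. -/
noncomputable def bridgeMean {m : ℕ} (k : Fin m → ℝ≥0) (T : ℝ≥0) (x₀ z : ℝ) (i : Fin m) : ℝ :=
  x₀ + k i / T * (z - x₀)

/-- The centred bridge at the times `k`. -/
noncomputable def bridgeNoise {Ω : Type*} (W : ℝ≥0 → Ω → ℝ) (σ : ℝ) {m : ℕ} (k : Fin m → ℝ≥0)
    (T : ℝ≥0) (ω : Ω) (i : Fin m) : ℝ :=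
  σ * (W (k i) ω - k i / T * W T ω)

section
variable {Ω : Type*} [MeasurableSpace Ω] {P : Measure Ω} [IsProbabilityMeasure P]
  {W X : ℝ≥0 → Ω → ℝ} {σ x₀ : ℝ} {m : ℕ} {k : Fin m → ℝ≥0} {T : ℝ≥0}

omit [IsProbabilityMeasure P] in
lemma hasGaussianLaw_bridgeNoise_prodMk (hW : IsBrownianReal W P) :
    HasGaussianLaw (fun ω ↦ ((fun i ↦ bridgeNoise W σ k T ω i), fun _ : Unit ↦ W T ω)) P := by
  classical
  set I : Finset ℝ≥0 := insert T (Finset.univ.image k) with hI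
  have hT : T ∈ I := Finset.mem_insert_self _ _
  have hk : ∀ i, k i ∈ I := fun i ↦
    Finset.mem_insert_of_mem (Finset.mem_image_of_mem k (Finset.mem_univ i))
  have := (hW.isGaussianProcess.hasGaussianLaw I).map_fun
    ((ContinuousLinearMap.pi fun i : Fin m ↦
      σ • (ContinuousLinearMap.proj (R := ℝ) (φ := fun _ : I ↦ ℝ) ⟨k i, hk i⟩ -
        ((k i / T : ℝ≥0) : ℝ) • ContinuousLinearMap.proj (R := ℝ) (φ := fun _ : I ↦ ℝ) ⟨T, hT⟩)).prod
    (ContinuousLinearMap.pi fun _ : Unit ↦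
      ContinuousLinearMap.proj (R := ℝ) (φ := fun _ : I ↦ ℝ) ⟨T, hT⟩))
  exact this.congr (.of_forall fun ω ↦ Prod.ext (funext fun i ↦ by simp [bridgeNoise]) rfl)

omit [IsProbabilityMeasure P] in
lemma memLp_brownian (hW : IsBrownianReal W P) (t : ℝ≥0) : MemLp (W t) 2 P :=
  (hW.isGaussianProcess.hasGaussianLaw_eval t).memLp_two

omit [IsProbabilityMeasure P] in
lemma hasGaussianLaw_bridgeNoise (hW : IsBrownianReal W P) :
    HasGaussianLaw (bridgeNoise W σ k T) P :=
  (hasGaussianLaw_bridgeNoise_prodMk hW).fst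

omit [IsProbabilityMeasure P] in
lemma memLp_bridgeNoise (hW : IsBrownianReal W P) (i : Fin m) :
    MemLp (fun ω ↦ bridgeNoise W σ k T ω i) 2 P :=
  ((memLp_brownian hW _).sub ((memLp_brownian hW _).const_mul _)).const_mul _

omit [IsProbabilityMeasure P] in
lemma integral_bridgeNoise (hW : IsBrownianReal W P) (i : Fin m) :
    ∫ ω, bridgeNoise W σ k T ω i ∂P = 0 := by
  simp only [bridgeNoise]
  rw [integral_const_mul, integral_sub (hW.integrable_eval _) ((hW.integrable_eval _).const_mul _),
    integral_const_mul, hW.integral_eval, hW.integral_eval]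
  simp

/-- `k i / T * W T` is the linear regression of `W (k i)` on `W T`, so what remains is orthogonal to
`W T`. -/
lemma cov_bridgeNoise_brownian (hW : IsBrownianReal W P) (hT : 0 < T) (hk : ∀ i, k i ≤ T)
    (i : Fin m) : cov[fun ω ↦ bridgeNoise W σ k T ω i, W T; P] = 0 := by
  simp only [bridgeNoise]
  rw [covariance_const_mul_left, covariance_fun_sub_left (memLp_brownian hW _)
    ((memLp_brownian hW _).const_mul _) (memLp_brownian hW _), covariance_const_mul_left]
  simp only [hW.covariance_fun_eval, min_eq_left (hk i), min_self]
  have : (T : ℝ) ≠ 0 := NNReal.coe_ne_zero.2 hT.ne'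
  field_simp
  simp

lemma cov_bridgeNoise (hW : IsBrownianReal W P) (hT : 0 < T) (hk : ∀ i, k i ≤ T)
    (i j : Fin m) : cov[fun ω ↦ bridgeNoise W σ k T ω i, fun ω ↦ bridgeNoise W σ k T ω j; P] =
      σ ^ 2 * (min (k i) (k j) - k i * k j / T) := by
  have h1 : cov[fun ω ↦ bridgeNoise W σ k T ω i, fun ω ↦ bridgeNoise W σ k T ω j; P] =
      σ * cov[fun ω ↦ bridgeNoise W σ k T ω i, W (k j); P] := by
    conv_lhs => enter [2]; unfold bridgeNoise
    rw [covariance_const_mul_right, covariance_fun_sub_right (memLp_bridgeNoise hW i)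
      (memLp_brownian hW _) ((memLp_brownian hW _).const_mul _), covariance_const_mul_right,
      cov_bridgeNoise_brownian hW hT hk]
    simp
  rw [h1]
  simp only [bridgeNoise]
  rw [covariance_const_mul_left, covariance_fun_sub_left (memLp_brownian hW _)
    ((memLp_brownian hW _).const_mul _) (memLp_brownian hW _), covariance_const_mul_left]
  simp only [hW.covariance_fun_eval, min_eq_right (hk j), NNReal.coe_min]
  ring

lemma indepFun_bridgeNoise (hW : IsBrownianReal W P) (hT : 0 < T) (hk : ∀ i, k i ≤ T) :
    IndepFun (bridgeNoise W σ k T) (W T) P := by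
  have := (hasGaussianLaw_bridgeNoise_prodMk (σ := σ) (k := k) (T := T) hW).indepFun_of_covariance_eval
    (X := fun i ω ↦ bridgeNoise W σ k T ω i) (Y := fun (_ : Unit) ω ↦ W T ω)
    fun i _ ↦ cov_bridgeNoise_brownian hW hT hk i
  exact this.comp measurable_id (measurable_pi_apply ())

/-- The law of the bridge from `x₀` to `z` at the times `k`. -/
noncomputable def bridgeLaw (hW : IsBrownianReal W P) (σ x₀ : ℝ) (k : Fin m → ℝ≥0) (T : ℝ≥0)
    (z : ℝ) : ProbabilityMeasure (Fin m → ℝ) :=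
  ⟨(P.map (bridgeNoise W σ k T)).map (· + bridgeMean k T x₀ z),
    have := Measure.isProbabilityMeasure_map (hasGaussianLaw_bridgeNoise (σ := σ) (k := k) (T := T)
      hW).aemeasurable
    Measure.isProbabilityMeasure_map (by fun_prop)⟩

lemma measurable_bridgeMean : Measurable fun z ↦ bridgeMean k T x₀ z := by
  unfold bridgeMean; fun_prop

lemma continuous_bridgeLaw (hW : IsBrownianReal W P) : Continuous (bridgeLaw hW σ x₀ k T) := by
  have := Measure.isProbabilityMeasure_map (hasGaussianLaw_bridgeNoise (σ := σ) (k := k) (T := T)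
    hW).aemeasurable
  rw [ProbabilityMeasure.continuous_iff_forall_continuous_integral]
  intro f
  simp only [bridgeLaw, ProbabilityMeasure.coe_mk]
  have h1 : ∀ z, ∫ x, f x ∂((P.map (bridgeNoise W σ k T)).map (· + bridgeMean k T x₀ z)) =
      ∫ x, f (x + bridgeMean k T x₀ z) ∂(P.map (bridgeNoise W σ k T)) := fun z ↦
    integral_map (by fun_prop) f.continuous.aestronglyMeasurable
  simp_rw [h1]
  have hc : Continuous fun z ↦ bridgeMean k T x₀ z := by unfold bridgeMean; fun_prop
  refine continuous_of_dominated (bound := fun _ ↦ ‖f‖) (fun z ↦ ?_) (fun z ↦ ?_)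
    (integrable_const _) (.of_forall fun x ↦ f.continuous.comp (continuous_const.add hc))
  · exact (f.continuous.comp (continuous_id.add continuous_const)).aestronglyMeasurable
  · exact .of_forall fun x ↦ f.norm_coe_le_norm _

/-- The transition kernel of the bridge laws. -/
noncomputable def bridgeKernel (hW : IsBrownianReal W P) (σ x₀ : ℝ) (k : Fin m → ℝ≥0) (T : ℝ≥0) :
    Kernel ℝ (Fin m → ℝ) where
  toFun z := bridgeLaw hW σ x₀ k T z
  measurable' := by
    have := Measure.isProbabilityMeasure_map (hasGaussianLaw_bridgeNoise (σ := σ) (k := k) (T := T)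
      hW).aemeasurable
    refine Measure.measurable_of_measurable_coe _ fun s hs ↦ ?_
    have h1 : ∀ z, (bridgeLaw hW σ x₀ k T z : Measure (Fin m → ℝ)) s =
        (P.map (bridgeNoise W σ k T)) (Prod.mk z ⁻¹' {p : ℝ × (Fin m → ℝ) |
          p.2 + bridgeMean k T x₀ p.1 ∈ s}) := fun z ↦ by
      simp only [bridgeLaw, ProbabilityMeasure.coe_mk]
      rw [Measure.map_apply (by fun_prop) hs]
      rfl
    simp_rw [h1]
    exact measurable_measure_prodMk_left
      ((measurable_snd.add (measurable_bridgeMean.comp measurable_fst)) hs)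

instance (hW : IsBrownianReal W P) : IsMarkovKernel (bridgeKernel hW σ x₀ k T) :=
  ⟨fun z ↦ (bridgeLaw hW σ x₀ k T z).2⟩

/-! ### Existence and uniqueness of the bridge law -/

variable (hX : ∀ t ω, X t ω = x₀ + σ * W t ω)
include hX

/-- The knots are the bridge mean with endpoint `X T` plus noise independent of `X T`, so given the
endpoint their law is a translate of the noise law. -/
lemma hasCondDistrib_bridgeKernel (hW : IsBrownianReal W P) (hT : 0 < T) (hk : ∀ i, k i ≤ T) :
    HasCondDistrib (fun ω i ↦ X (k i) ω) (X T) (bridgeKernel hW σ x₀ k T) P := by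
  have hWm : ∀ t, AEMeasurable (W t) P := hW.aemeasurable
  have hXm : ∀ t, AEMeasurable (X t) P := fun t ↦ by
    have : X t = fun ω ↦ x₀ + σ * W t ω := funext (hX t)
    rw [this]
    exact ((hWm t).const_mul σ).const_add x₀
  have hVm : AEMeasurable (bridgeNoise W σ k T) P := (hasGaussianLaw_bridgeNoise hW).aemeasurable
  have := Measure.isProbabilityMeasure_map hVm
  have := Measure.isProbabilityMeasure_map (hXm T)
  have hind : IndepFun (X T) (bridgeNoise W σ k T) P := by
    have : X T = (fun w ↦ x₀ + σ * w) ∘ W T := funext (hX T)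
    rw [this]
    exact (indepFun_bridgeNoise hW hT hk).symm.comp (by fun_prop) measurable_id
  have hφ : Measurable fun p : ℝ × (Fin m → ℝ) ↦ (p.1, p.2 + bridgeMean k T x₀ p.1) :=
    measurable_fst.prodMk (measurable_snd.add (measurable_bridgeMean.comp measurable_fst))
  have hdecomp : (fun ω ↦ (X T ω, fun i ↦ X (k i) ω)) =
      (fun p : ℝ × (Fin m → ℝ) ↦ (p.1, p.2 + bridgeMean k T x₀ p.1)) ∘
        fun ω ↦ (X T ω, bridgeNoise W σ k T ω) := by
    ext1 ω
    refine Prod.ext rfl (funext fun i ↦ ?_)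
    simp only [Function.comp_apply, Pi.add_apply, bridgeNoise, bridgeMean, hX]
    ring
  refine ⟨(hXm T).prodMk (aemeasurable_pi_lambda _ fun i ↦ hXm (k i)), ?_⟩
  rw [hdecomp, ← AEMeasurable.map_map_of_aemeasurable hφ.aemeasurable ((hXm T).prodMk hVm),
    (indepFun_iff_map_prod_eq_prod_map_map (hXm T) hVm).1 hind]
  ext s hs
  rw [Measure.map_apply hφ hs, Measure.prod_apply (hφ hs), Measure.compProd_apply hs]
  refine lintegral_congr fun z ↦ ?_
  change _ = (bridgeLaw hW σ x₀ k T z : Measure (Fin m → ℝ)) _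
  simp only [bridgeLaw, ProbabilityMeasure.coe_mk]
  rw [Measure.map_apply (by fun_prop) (measurable_prodMk_left hs)]
  rfl

lemma isBridgeLaw_bridgeLaw (hW : IsBrownianReal W P) (hT : 0 < T) (hk : ∀ i, k i ≤ T) (z : ℝ) :
    IsBridgeLaw P X k T z (bridgeLaw hW σ x₀ k T z) :=
  ⟨bridgeKernel hW σ x₀ k T, _, hasCondDistrib_bridgeKernel hX hW hT hk, continuous_bridgeLaw hW,
    fun _ ↦ rfl, rfl⟩

/-- Two versions of the conditional law agree almost everywhere for the law of `X T`. That law is a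
nondegenerate Gaussian and charges every open set, so weakly continuous versions agree at every
point. -/
lemma eq_bridgeLaw_of_isBridgeLaw (hW : IsBrownianReal W P) (hT : 0 < T) (hk : ∀ i, k i ≤ T)
    (hσ : 0 < σ) {z : ℝ} {H : ProbabilityMeasure (Fin m → ℝ)} (h : IsBridgeLaw P X k T z H) :
    H = bridgeLaw hW σ x₀ k T z := by
  obtain ⟨κ, g, hκ, hg, hκg, rfl⟩ := h
  have hκM : IsMarkovKernel κ := ⟨fun z ↦ by rw [hκg]; infer_instance⟩
  have hlaw := gaussianReal_const_add (gaussianReal_const_mul (hW.hasLaw_eval T) σ) x₀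
  rw [← (funext (hX T) : X T = fun ω ↦ x₀ + σ * W T ω)] at hlaw
  have hopen : (P.map (X T)).IsOpenPosMeasure := by
    rw [hlaw.map_eq]
    refine (gaussianReal_absolutelyContinuous' _ (mul_ne_zero ?_ hT.ne')).isOpenPosMeasure
    intro h0
    exact (pow_pos hσ 2).ne' (congrArg NNReal.toReal h0)
  have := Measure.isProbabilityMeasure_map hlaw.aemeasurable
  have hae : κ =ᵐ[P.map (X T)] bridgeKernel hW σ x₀ k T := by
    refine Kernel.ae_eq_of_compProd_eq ?_
    rw [← hκ.map_eq, (hasCondDistrib_bridgeKernel hX hW hT hk).map_eq]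
  have hae' : g =ᵐ[P.map (X T)] bridgeLaw hW σ x₀ k T := by
    filter_upwards [hae] with y hy
    refine Subtype.ext ?_
    change (g y : Measure (Fin m → ℝ)) = _
    rw [← hκg, hy]
    rfl
  exact congrFun ((hg.ae_eq_iff_eq _ (continuous_bridgeLaw hW)).1 hae') z

omit hX

lemma isGaussian_bridgeLaw (hW : IsBrownianReal W P) (z : ℝ) :
    IsGaussian (bridgeLaw hW σ x₀ k T z : Measure (Fin m → ℝ)) := by
  have := (hasGaussianLaw_bridgeNoise (σ := σ) (k := k) (T := T) hW).isGaussian_map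
  simp only [bridgeLaw, ProbabilityMeasure.coe_mk]
  infer_instance

lemma bridgeLaw_eq_map (hW : IsBrownianReal W P) (z : ℝ) :
    (bridgeLaw hW σ x₀ k T z : Measure (Fin m → ℝ)) =
      P.map fun ω ↦ bridgeNoise W σ k T ω + bridgeMean k T x₀ z :=
  AEMeasurable.map_map_of_aemeasurable (by fun_prop) (hasGaussianLaw_bridgeNoise hW).aemeasurable

omit [IsProbabilityMeasure P] in
lemma aemeasurable_bridge (hW : IsBrownianReal W P) (z : ℝ) :
    AEMeasurable (fun ω ↦ bridgeNoise W σ k T ω + bridgeMean k T x₀ z) P :=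
  (hasGaussianLaw_bridgeNoise hW).aemeasurable.add_const _

lemma integral_bridgeLaw (hW : IsBrownianReal W P) (z : ℝ) (i : Fin m) :
    ∫ x, x i ∂(bridgeLaw hW σ x₀ k T z : Measure (Fin m → ℝ)) = bridgeMean k T x₀ z i := by
  rw [bridgeLaw_eq_map, integral_map (aemeasurable_bridge hW z)
    (measurable_pi_apply i).aestronglyMeasurable]
  simp only [Pi.add_apply]
  rw [integral_add ((memLp_bridgeNoise hW i).integrable (by norm_num)) (integrable_const _),
    integral_bridgeNoise hW]
  simp

lemma cov_bridgeLaw (hW : IsBrownianReal W P) (hT : 0 < T) (hk : ∀ i, k i ≤ T) (z : ℝ)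
    (i j : Fin m) :
    cov[fun x ↦ x i, fun x ↦ x j; (bridgeLaw hW σ x₀ k T z : Measure (Fin m → ℝ))] =
      σ ^ 2 * (min (k i) (k j) - k i * k j / T) := by
  have hint : ∀ i, Integrable (fun ω ↦ bridgeNoise W σ k T ω i) P :=
    fun i ↦ (memLp_bridgeNoise hW i).integrable (by norm_num)
  rw [bridgeLaw_eq_map, covariance_map_fun (measurable_pi_apply i).aestronglyMeasurable
    (measurable_pi_apply j).aestronglyMeasurable (aemeasurable_bridge hW z)]
  simp only [Pi.add_apply]
  rw [covariance_add_const_left (hint i), covariance_add_const_right (hint j),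
    cov_bridgeNoise hW hT hk]

end

/-! ### The autoregression of the bridge at equidistant anchors -/

/-- Half the adjacency matrix of a path. -/
noncomputable def halfAdj (m : ℕ) : Matrix (Fin m) (Fin m) ℝ :=
  Matrix.of fun i j ↦ if (i : ℕ) + 1 = j ∨ (j : ℕ) + 1 = i then 1 / 2 else 0

section
variable {m : ℕ}

lemma halfAdj_ne_zero {i j : Fin m} (h : halfAdj m i j ≠ 0) :
    (i : ℕ) + 1 = j ∨ (j : ℕ) + 1 = i := by
  by_contra h'
  exact h (by simp [halfAdj, h'])

/-- Index `i` stands for the site `i + 1`. The zero boundary values at `0` and `m + 1` supply the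
missing neighbours of the end sites. -/
lemma sum_halfAdj {F : ℕ → ℝ} (h0 : F 0 = 0) (hm : F (m + 1) = 0) (i : Fin m) :
    ∑ j, halfAdj m i j * F (j + 1) = (F i + F (i + 2)) / 2 := by
  have hsplit : ∀ j : Fin m, halfAdj m i j * F (j + 1) =
      (if (j : ℕ) + 1 = i then F i / 2 else 0) + if (i : ℕ) + 1 = j then F (i + 2) / 2 else 0 := by
    intro j
    simp only [halfAdj, Matrix.of_apply]
    by_cases h1 : (j : ℕ) + 1 = i
    · rw [if_pos (Or.inr h1), if_pos h1, if_neg (by omega), h1]; ring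
    · by_cases h2 : (i : ℕ) + 1 = j
      · rw [if_pos (Or.inl h2), if_neg h1, if_pos h2, ← h2]; ring_nf
      · rw [if_neg (by tauto), if_neg h1, if_neg h2]; ring
  simp_rw [hsplit, Finset.sum_add_distrib]
  have hl : ∑ j : Fin m, (if (j : ℕ) + 1 = i then F i / 2 else 0) = F i / 2 := by
    by_cases hi : (i : ℕ) = 0
    · rw [hi, h0]; simp
    · rw [Finset.sum_eq_single ⟨(i : ℕ) - 1, by omega⟩]
      · rw [if_pos (by simp; omega)]
      · intro j _ hj
        rw [if_neg]
        intro h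
        exact hj (Fin.ext (by simp; omega))
      · simp
  have hr : ∑ j : Fin m, (if (i : ℕ) + 1 = j then F (i + 2) / 2 else 0) = F (i + 2) / 2 := by
    by_cases hi : (i : ℕ) + 1 = m
    · rw [show (i : ℕ) + 2 = m + 1 by omega, hm]; simp
    · rw [Finset.sum_eq_single ⟨(i : ℕ) + 1, by omega⟩]
      · rw [if_pos rfl]
      · intro j _ hj
        rw [if_neg]
        intro h
        exact hj (Fin.ext h.symm)
      · simp
  rw [hl, hr]
  ring

lemma halfAdj_mulVec_sin : (halfAdj m).mulVec
      (fun i ↦ Real.sin (((i + 1 : ℕ) : ℝ) * (Real.pi / (m + 1)))) =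
    Real.cos (Real.pi / (m + 1)) •
      fun i : Fin m ↦ Real.sin (((i + 1 : ℕ) : ℝ) * (Real.pi / (m + 1))) := by
  ext i
  have h := sum_halfAdj (m := m) (F := fun n ↦ Real.sin ((n : ℝ) * (Real.pi / (m + 1)))) (by simp)
    (by
      have : ((m + 1 : ℕ) : ℝ) * (Real.pi / (m + 1)) = Real.pi := by
        push_cast; field_simp
      simp only [this, Real.sin_pi]) i
  simp only [Matrix.mulVec, dotProduct, Pi.smul_apply, smul_eq_mul] at h ⊢
  rw [h]
  set θ := Real.pi / ((m : ℝ) + 1)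
  have e1 : ((i : ℕ) : ℝ) * θ = ((i + 1 : ℕ) : ℝ) * θ - θ := by push_cast; ring
  have e2 : ((i + 2 : ℕ) : ℝ) * θ = ((i + 1 : ℕ) : ℝ) * θ + θ := by push_cast; ring
  rw [e1, e2, Real.sin_sub, Real.sin_add]
  ring

lemma sin_anchor_pos (i : Fin m) : 0 < Real.sin (((i + 1 : ℕ) : ℝ) * (Real.pi / (m + 1))) := by
  refine Real.sin_pos_of_pos_of_lt_pi (by have := Real.pi_pos; positivity) ?_
  rw [mul_div_assoc', div_lt_iff₀ (by positivity), mul_comm]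
  have : ((i + 1 : ℕ) : ℝ) < m + 1 := by exact_mod_cast Nat.succ_lt_succ i.2
  exact mul_lt_mul_of_pos_left this Real.pi_pos

lemma anchor_le (T : ℝ≥0) (i : Fin m) : anchor m T i ≤ T := by
  have h : ((i : ℕ) : ℝ≥0) + 1 ≤ m + 1 := by exact_mod_cast Nat.succ_le_succ i.2.le
  calc anchor m T i ≤ (m + 1) * (T / (m + 1)) := mul_le_mul_left h _
    _ = T := mul_div_cancel₀ T (by positivity)

variable {Ω : Type*} [MeasurableSpace Ω] {P : Measure Ω} [IsProbabilityMeasure P]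
  {W X : ℝ≥0 → Ω → ℝ} {σ x₀ : ℝ} {T : ℝ≥0}

theorem isAutoregressive_bridgeLaw (hW : IsBrownianReal W P) (hT : 0 < T) (hσ : 0 < σ) (z : ℝ) :
    IsAutoregressive (bridgeLaw hW σ x₀ (anchor m T) T z : Measure (Fin m → ℝ))
      (bridgeMean (anchor m T) T x₀ z) (halfAdj m) (σ ^ 2 * (T / (m + 1)) / 2) where
  gaussian := isGaussian_bridgeLaw hW z
  mean := integral_bridgeLaw hW z
  nonneg i j := by simp only [halfAdj, Matrix.of_apply]; split_ifs <;> norm_num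
  diag i := by simp [halfAdj]
  pos := by
    have : (0 : ℝ) < T := hT
    positivity
  cov_sub i j := by
    simp_rw [cov_bridgeLaw hW hT (anchor_le T)]
    have hT' : (T : ℝ) ≠ 0 := NNReal.coe_ne_zero.2 hT.ne'
    set δ : ℝ := T / (m + 1) with hδ
    have hδ0 : 0 ≤ δ := by positivity
    have hanchor : ∀ i : Fin m, (anchor m T i : ℝ) = ((i + 1 : ℕ) : ℝ) * δ := fun i ↦ by
      simp [anchor, hδ]
    have hTδ : (T : ℝ) = (m + 1) * δ := by rw [hδ]; field_simp
    set F : ℕ → ℝ := fun n ↦ σ ^ 2 * (min (n * δ) (((j + 1 : ℕ) : ℝ) * δ) -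
      n * δ * (((j + 1 : ℕ) : ℝ) * δ) / T) with hF
    have hF0 : F 0 = 0 := by
      simp only [hF, Nat.cast_zero, zero_mul, zero_div, sub_zero]
      rw [min_eq_left (by positivity), mul_zero]
    have hj : ((j + 1 : ℕ) : ℝ) ≤ ((m + 1 : ℕ) : ℝ) := by exact_mod_cast Nat.succ_le_succ j.2.le
    have hFm : F (m + 1) = 0 := by
      simp only [hF]
      rw [min_eq_right (mul_le_mul_of_nonneg_right hj hδ0)]
      have : ((m + 1 : ℕ) : ℝ) * δ = T := by rw [hTδ]; push_cast; ring
      rw [this]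
      field_simp
      simp
    have hsum := sum_halfAdj hF0 hFm i
    simp only [hanchor, NNReal.coe_min]
    change F (i + 1) - ∑ l, halfAdj m i l * F (l + 1) = _
    rw [hsum]
    -- A kink at `j + 1` minus a linear function: the latter drops out of the second difference, and
    -- the kink contributes `σ ^ 2 * δ / 2` exactly when `i = j`.
    have hlin : ∀ n : ℕ, F n = σ ^ 2 * δ * (min n (j + 1 : ℕ) : ℕ) -
        n * (σ ^ 2 * (δ * (((j + 1 : ℕ) : ℝ) * δ) / T)) := fun n ↦ by
      simp only [hF]
      rw [← min_mul_of_nonneg _ _ hδ0, ← Nat.cast_min]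
      ring
    rw [hlin, hlin, hlin]
    rcases lt_trichotomy (i : ℕ) j with h | h | h
    · rw [if_neg (fun e ↦ by simp [e] at h), min_eq_left (by omega), min_eq_left (by omega),
        min_eq_left (by omega)]
      push_cast; ring
    · rw [if_pos (Fin.ext h), min_eq_left (by omega), min_eq_left (by omega),
        min_eq_right (by omega), h]
      push_cast; ring
    · rw [if_neg (fun e ↦ by simp [e] at h), min_eq_right (by omega), min_eq_right (by omega),
        min_eq_right (by omega)]
      push_cast; ring

lemma IsAutoregressive.matrixA_eq {G : ProbabilityMeasure (Fin m → ℝ)} {c : Fin m → ℝ}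
    {A : Matrix (Fin m) (Fin m) ℝ} {κ : ℝ}
    (h : IsAutoregressive (G : Measure (Fin m → ℝ)) c A κ) : matrixA G = A := by
  have h1 : (κ⁻¹ • (1 - A)) * covMatrix G = 1 := by
    rw [smul_mul_assoc, covMatrix, h.one_sub_mul_cov, smul_smul, inv_mul_cancel₀ h.pos.ne',
      one_smul]
  have h2 : (covMatrix G)⁻¹ = κ⁻¹ • (1 - A) := Matrix.inv_eq_left_inv h1
  rw [matrixA, h2]
  have h3 : Matrix.diagonal (fun i ↦ ((κ⁻¹ • (1 - A)) i i)⁻¹) = κ • (1 : Matrix (Fin m) (Fin m) ℝ) := by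
    rw [Matrix.smul_one_eq_diagonal]
    congr 1
    ext i
    simp [h.diag]
  rw [h3, smul_mul_assoc, one_mul, smul_smul, mul_inv_cancel₀ h.pos.ne', one_smul, sub_sub_cancel]

lemma corr_bridgeLaw (hW : IsBrownianReal W P) {δ : ℝ≥0} (hδ : 0 < δ) (hσ : 0 < σ) (z : ℝ) :
    corr (bridgeLaw hW σ x₀ ![δ, 2 * δ] (3 * δ) z) 0 1 = 1 / 2 := by
  have hk : ∀ i, (![δ, 2 * δ] : Fin 2 → ℝ≥0) i ≤ 3 * δ := by
    intro i
    fin_cases i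
    · exact le_mul_of_one_le_left zero_le (by norm_num)
    · exact mul_le_mul_left (by norm_num) δ
  have hδ' : (0 : ℝ) < δ := hδ
  have hc := cov_bridgeLaw (σ := σ) (x₀ := x₀) hW (T := 3 * δ) (by positivity) hk z
  have h01 := hc 0 1
  have hv : ∀ i, Var[fun x : Fin 2 → ℝ ↦ x i;
      (bridgeLaw hW σ x₀ ![δ, 2 * δ] (3 * δ) z : Measure (Fin 2 → ℝ))] =
      2 / 3 * (σ ^ 2 * δ) := fun i ↦ by
    rw [← covariance_self (measurable_pi_apply i).aemeasurable, hc]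
    fin_cases i
    · simp; field_simp; ring
    · simp; field_simp; ring
  have h01' : cov[fun x : Fin 2 → ℝ ↦ x 0, fun x ↦ x 1;
      (bridgeLaw hW σ x₀ ![δ, 2 * δ] (3 * δ) z : Measure (Fin 2 → ℝ))] = 1 / 3 * (σ ^ 2 * δ) := by
    rw [h01]
    have : min (δ : ℝ) (2 * δ) = δ := min_eq_left (by linarith)
    simp [this]; field_simp; ring
  rw [corr, hv, hv, h01', Real.sqrt_mul_self (by positivity)]
  field_simp

end

/-! ### Interlaced blocks -/

lemma IsBlocking.exists_eq_levelBlocks {m k : ℕ} {𝒜 : Fin k → Finset (Fin m)}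
    (h : IsBlocking 𝒜) : ∃ l : Fin m → Fin k, 𝒜 = levelBlocks l := by
  choose l hl using h.2.2
  refine ⟨l, funext fun a ↦ Finset.ext fun i ↦ ?_⟩
  simp only [levelBlocks, Finset.mem_filter, Finset.mem_univ, true_and]
  refine ⟨fun hi ↦ ?_, fun hi ↦ hi ▸ hl i⟩
  by_contra hne
  exact Finset.disjoint_left.1 (h.2.1 _ _ hne) (hl i) hi

/-- Two adjacent anchors in one block would need an anchor strictly between them. -/
lemma Interlaced.level_ne {m : ℕ} {l : Fin m → Fin 2} (h : Interlaced (levelBlocks l)) {i j : Fin m}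
    (hij : (i : ℕ) + 1 = j) : l i ≠ l j := by
  intro he
  obtain ⟨b, -, h1, h2⟩ := h (l i) (l i + 1) (by generalize l i = a; fin_cases a <;> decide) i
    (by simp [levelBlocks]) j (by simp [levelBlocks, he]) (Fin.lt_def.2 (by omega))
  rw [Fin.lt_def] at h1 h2
  omega

lemma IsBlocking.two_le {m : ℕ} {𝒜 : Fin 2 → Finset (Fin m)} (h : IsBlocking 𝒜) : 2 ≤ m := by
  obtain ⟨a, ha⟩ := h.1 0
  obtain ⟨b, hb⟩ := h.1 1
  have hab : a ≠ b := fun e ↦ Finset.disjoint_left.1 (h.2.1 0 1 (by decide)) ha (e ▸ hb)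
  have := Fin.val_ne_of_ne hab
  omega

/-! ### Asymptotics -/

/-- The generous constant makes the bound global: for `|x| ≥ 1` the right side is at least `1`. -/
lemma cos_le_one_sub_sq_add {x : ℝ} : Real.cos x ≤ 1 - x ^ 2 / 2 + 4 * x ^ 4 := by
  rcases le_total |x| 1 with h | h
  · have h1 := (abs_le.1 (Real.cos_bound h)).2
    have : |x| ^ 4 = x ^ 4 := by rw [show 4 = 2 * 2 by norm_num, pow_mul, sq_abs, ← pow_mul]
    rw [this] at h1
    nlinarith [sq_nonneg (x ^ 2)]
  · have h2 : 1 ≤ x ^ 2 := by rw [← sq_abs]; nlinarith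
    nlinarith [Real.cos_le_one x]

lemma exp_neg_le_quadratic {y : ℝ} (hy : 0 ≤ y) : Real.exp (-y) ≤ 1 - y + y ^ 2 / 2 := by
  rw [Real.exp_neg, inv_le_iff_one_le_mul₀ (Real.exp_pos y)]
  have h := Real.quadratic_le_exp_of_nonneg hy
  have h2 : 0 < 1 - y + y ^ 2 / 2 := by nlinarith [sq_nonneg (y - 1)]
  calc (1 : ℝ) ≤ (1 - y + y ^ 2 / 2) * (1 + y + y ^ 2 / 2) := by nlinarith [sq_nonneg (y ^ 2)]
    _ ≤ _ := mul_le_mul_of_nonneg_left h h2.le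

lemma abs_cos_sq_sub_le (x : ℝ) : |Real.cos x ^ 2 - (1 - x ^ 2)| ≤ 9 * x ^ 4 := by
  have h1 := Real.one_sub_sq_div_two_le_cos (x := x)
  have h2 := cos_le_one_sub_sq_add (x := x)
  have h3 := Real.cos_le_one x
  have h4 : (1 - Real.cos x) ^ 2 ≤ (x ^ 2 / 2) ^ 2 := by
    apply pow_le_pow_left₀ <;> linarith
  rw [abs_le]
  constructor <;> nlinarith [sq_nonneg (1 - Real.cos x), sq_nonneg (x ^ 2)]

/-- With `y = 1 - cos x`, Bernoulli's inequality below and the exponential above give `1 - y ≤ (1 -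
y / m) ^ m ≤ 1 - y + y ^ 2 / 2`, uniformly in `m`; moreover `y` is `x ^ 2 / 2` up to order `x ^ 4`.
-/
lemma abs_pow_sub_le {m : ℕ} [NeZero m] {x : ℝ} (hx : 0 ≤ Real.cos x) :
    |((m - 1 + Real.cos x) / m) ^ m - (1 - 1 / 2 * x ^ 2)| ≤ 9 * x ^ 4 := by
  have hm : (1 : ℝ) ≤ m := by exact_mod_cast NeZero.one_le
  have h1 := Real.one_sub_sq_div_two_le_cos (x := x)
  have h2 := cos_le_one_sub_sq_add (x := x)
  have h3 := Real.cos_le_one x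
  set y := 1 - Real.cos x with hy
  have hbase : (m - 1 + Real.cos x) / m = 1 - y / m := by rw [hy]; field_simp; ring
  have hyu : y ^ 2 ≤ (x ^ 2 / 2) ^ 2 := by apply pow_le_pow_left₀ <;> linarith
  have hup : (1 - y / m) ^ m ≤ 1 - y + y ^ 2 / 2 :=
    (Real.one_sub_div_pow_le_exp_neg (by linarith)).trans (exp_neg_le_quadratic (by linarith))
  have hlow : 1 - y ≤ (1 - y / m) ^ m := by
    have h := one_add_mul_le_pow (a := -(y / m)) (by
      have : y / m ≤ 1 := by rw [div_le_one (by linarith)]; linarith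
      linarith) m
    have e : 1 + (m : ℝ) * -(y / m) = 1 - y := by field_simp; ring
    rw [e] at h
    rwa [← sub_eq_add_neg] at h
  rw [hbase, abs_le]
  constructor <;> nlinarith [sq_nonneg y, sq_nonneg (x ^ 2)]

lemma anchor_angle_pow_le {m : ℕ} [NeZero m] :
    9 * (Real.pi / (m + 1)) ^ 4 ≤ 9 * Real.pi ^ 4 / m ^ 4 := by
  have hm : (0 : ℝ) < m := by exact_mod_cast NeZero.pos m
  rw [div_pow, mul_div_assoc]
  gcongr
  linarith

lemma cos_anchor_angle_pos {m : ℕ} (hm : 2 ≤ m) : 0 < Real.cos (Real.pi / (m + 1)) := by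
  have hm' : (2 : ℝ) ≤ m := by exact_mod_cast hm
  refine Real.cos_pos_of_mem_Ioo ⟨?_, ?_⟩
  · have : 0 < Real.pi / (m + 1) := by have := Real.pi_pos; positivity
    linarith [Real.pi_pos]
  · exact div_lt_div_of_pos_left Real.pi_pos (by norm_num) (by linarith)

lemma cos_anchor_angle_nonneg {m : ℕ} [NeZero m] : 0 ≤ Real.cos (Real.pi / (m + 1)) := by
  have hm : (1 : ℝ) ≤ m := by exact_mod_cast NeZero.one_le
  refine Real.cos_nonneg_of_mem_Icc ⟨?_, ?_⟩
  · have : 0 < Real.pi / (m + 1) := by have := Real.pi_pos; positivity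
    linarith [Real.pi_pos]
  · exact div_le_div_of_nonneg_left Real.pi_pos.le (by norm_num) (by linarith)

/-- For `m = 1` the cosine vanishes, but only the exponent `0` occurs, so the rescaled eigenvector
of the lexicographic sweep stays positive. -/
lemma cos_anchor_angle_pow_pos {m n : ℕ} (hn : n < m) :
    0 < Real.cos (Real.pi / (m + 1)) ^ n := by
  rcases Nat.lt_or_ge m 2 with h | h
  · have : n = 0 := by omega
    simp [this]
  · exact pow_pos (cos_anchor_angle_pos h) n

end BridgeBlocking

/-! ### The main theorem -/

open BridgeBlocking in
theorem corollary1 :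
    ∃ C : ℝ, ∀ (m : ℕ) [NeZero m] (T : ℝ≥0) (_ : 0 < T) (σ : ℝ) (_ : 0 < σ) (x₀ x_T : ℝ)
      (Ω : Type*) [MeasurableSpace Ω] (P : Measure Ω) [IsProbabilityMeasure P]
      (W X : ℝ≥0 → Ω → ℝ) (_ : IsBrownianReal W P) (_ : ∀ t ω, X t ω = x₀ + σ * W t ω),
      -- the partial correlation `c(δ) = Corr(X_δ, X_{2δ} | X_0, X_{3δ})`, with `δ = T / (m + 1)`
      (∀ z : ℝ,
        (∃ H, IsBridgeLaw P X ![T / (m + 1), 2 * (T / (m + 1))] (3 * (T / (m + 1))) z H) ∧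
        ∀ H, IsBridgeLaw P X ![T / (m + 1), 2 * (T / (m + 1))] (3 * (T / (m + 1))) z H →
          corr H 0 1 = 1 / 2) ∧
      -- the law `G` of the knots of the bridge from `x₀` to `x_T`, and the rates
      (∃ G, IsBridgeLaw P X (anchor m T) T x_T G) ∧
      ∀ G, IsBridgeLaw P X (anchor m T) T x_T G →
        ∃ ρ ρ_rand : ℝ,
          -- `ρ = ρ_check = ρ_lex = ρ_spec(B_lex) = ρ_spec(B_check) = λ_max(A)²`
          (∀ 𝒜 : Fin 2 → Finset (Fin m), IsBlocking 𝒜 → Interlaced 𝒜 →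
            IsL2Rate (checkerboardSweep G 𝒜) G ρ ∧
            ∃ B, IsSweepMatrix (checkerboardSweep G 𝒜) G B ∧ HasSpectralRadius B ρ) ∧
          IsL2Rate (lexSweep G) G ρ ∧
          (∃ B, IsSweepMatrix (lexSweep G) G B ∧ HasSpectralRadius B ρ) ∧
          (∃ μ : ℝ, IsGreatest {μ | Module.End.HasEigenvalue (Matrix.toLin' (matrixA G)) μ} μ ∧
            ρ = μ ^ 2) ∧
          IsL2Rate (randomSweep G) G ρ_rand ∧
          -- the closed forms
          ρ = Real.cos (Real.pi / (m + 1)) ^ 2 ∧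
          ρ_rand = ((m - 1 + Real.cos (Real.pi / (m + 1))) / m) ^ m ∧
          -- the asymptotics, with a constant that depends on nothing
          |ρ - (1 - (Real.pi / (m + 1)) ^ 2)| ≤ C / m ^ 4 ∧
          |ρ_rand - (1 - 1 / 2 * (Real.pi / (m + 1)) ^ 2)| ≤ C / m ^ 4 := by
  refine ⟨9 * Real.pi ^ 4, ?_⟩
  intro m _ T hT σ hσ x₀ x_T Ω _ P _ W X hW hX
  refine ⟨fun z ↦ ?_, ⟨_, isBridgeLaw_bridgeLaw hX hW hT (anchor_le T) x_T⟩, fun G hG ↦ ?_⟩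
  · have hδ : 0 < T / (m + 1) := by positivity
    have hδ' : 0 < 3 * (T / (m + 1)) := by positivity
    have hk : ∀ i, (![T / (m + 1), 2 * (T / (m + 1))] : Fin 2 → ℝ≥0) i ≤ 3 * (T / (m + 1)) := by
      intro i
      fin_cases i
      · exact le_mul_of_one_le_left zero_le (by norm_num)
      · exact mul_le_mul_left (by norm_num) _
    refine ⟨⟨_, isBridgeLaw_bridgeLaw hX hW hδ' hk z⟩, fun H hH ↦ ?_⟩
    rw [eq_bridgeLaw_of_isBridgeLaw hX hW hδ' hk hσ hH]
    exact corr_bridgeLaw hW hδ hσ z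
  have hA := isAutoregressive_bridgeLaw (m := m) (x₀ := x₀) hW hT hσ x_T
  rw [← eq_bridgeLaw_of_isBridgeLaw hX hW hT (anchor_le T) hσ hG] at hA
  -- Each knot is its own level, and path neighbours have consecutive indices.
  have hlex := hA.isL2Rate_sweep (l := id) (fun i j h ↦ halfAdj_ne_zero h) sin_anchor_pos
    halfAdj_mulVec_sin (fun i ↦ cos_anchor_angle_pow_pos i.2)
    (fun i ↦ cos_anchor_angle_pow_pos (Fin.rev i).2)
  have hlexSweep : sweep G (levelBlocks id) PMF.pure = lexSweep G := by
    rw [lexSweep]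
    congr 1
    ext a i
    simp [levelBlocks]
  rw [hlexSweep] at hlex
  refine ⟨Real.cos (Real.pi / (m + 1)) ^ 2, ((m - 1 + Real.cos (Real.pi / (m + 1))) / m) ^ m,
    fun 𝒜 hB hI ↦ ?_, hlex.1, hlex.2, ⟨_, ?_, rfl⟩,
    hA.isL2Rate_randomSweep sin_anchor_pos halfAdj_mulVec_sin, rfl, rfl,
    (abs_cos_sq_sub_le _).trans anchor_angle_pow_le,
    (abs_pow_sub_le cos_anchor_angle_nonneg).trans anchor_angle_pow_le⟩
  · have hc := cos_anchor_angle_pos hB.two_le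
    obtain ⟨l, rfl⟩ := hB.exists_eq_levelBlocks
    refine hA.isL2Rate_sweep (l := l) (fun i j h ↦ ?_) sin_anchor_pos halfAdj_mulVec_sin
      (fun i ↦ pow_pos hc _) (fun i ↦ pow_pos hc _)
    -- With only two levels, being different already means being consecutive.
    have hne : l i ≠ l j := by
      rcases halfAdj_ne_zero h with h | h
      exacts [hI.level_ne h, (hI.level_ne h).symm]
    have := Fin.val_ne_of_ne hne
    omega
  · rw [hA.matrixA_eq]
    exact isGreatest_eigenvalue_of_mulVec_eq hA.nonneg sin_anchor_pos halfAdj_mulVec_sin
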